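/- Let $\tau,\beta>0$ and consider a $d$-dimensional quantum system whose state $\varrho_t$, $t\in[0,\tau]$, is continuous in $t$ and solves the Lindblad equation $$\dot\varrho_t=-i[H_t,\varrho_t]+\sum_k\Big(L_k(t)\varrho_tL_k(t)^\dagger-\tfrac12\{L_k(t)^\dagger L_k(t),\varrho_t\}\Big),\qquad \varrho_0=\mathbb I/d,$$ in integrated form (so $\dot\varrho_t$ exists for almost every $t$), where $k$ runs over a finite set, $H_t$ is Hermitian, and $H_t$ and the $L_k(t)$ are bounded and measurable in $t\in[0,\tau]$ (discontinuous protocols are allowed). Assume detailed balance at inverse temperature $\beta$: there are real numbers $\omega_k(t)$ and an involution $k\mapsto k'$ of the index set such that for all $t\in[0,\tau]$ and all $k$ $$[L_k(t),H_t]=\omega_k(t)L_k(t),\qquad L_k(t)=e^{\beta\omega_k(t)/2}L_{k'}(t)^\dagger .$$ Let $Q=-\int_0^\tau\mathrm{Tr}(H_t\dot\varrho_t)\,dt$ be the dissipated heat, $\Delta S=S(\varrho_0)-S(\varrho_\tau)$ the decrease of the von Neumann entropy $S(\varrho)=-\mathrm{Tr}(\varrho\ln\varrho)$, $\overline\gamma_\tau=\tau^{-1}\int_0^\tau\sum_k\mathrm{Tr}(\varrho_tL_k(t)^\dagger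 L_k(t))\,dt$ the time-averaged dynamical activity, and $\|A\|_1=\mathrm{Tr}\sqrt{A^\dagger A}$ the trace norm. Then $$\beta Q\ \ge\ \Delta S+\frac{\|\varrho_0-\varrho_\tau\|_1^2}{2\tau\overline\gamma_\tau}.$$ Consequently, for every pure target state $|0\rangle$ (any unit vector) with reset error $\epsilon=\|\varrho_\tau-|0\rangle\langle 0|\|_1$, $$\beta Q\ \ge\ \Delta S+\frac{\|\varrho_0-\varrho_\tau\|_1^2}{2\tau\overline\gamma_\tau}\ \ge\ \Delta S+\frac{[2(1-1/d)-\epsilon]^2}{2\tau\overline\gamma_\tau}.$$ (If $\overline\gamma_\tau=0$, the fractions are read as $0$.) -/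

import Mathlib

open scoped Matrix

namespace QuantumLandauer

noncomputable section

/-- The trace norm `‖A‖₁ = Tr √(Aᴴ A)`. -/
def traceNorm {d : ℕ} (A : Matrix (Fin d) (Fin d) ℂ) : ℝ :=
  (cfc Real.sqrt (Aᴴ * A)).trace.re

/-- The von Neumann entropy `S(ρ) = -Tr (ρ ln ρ)`, with the convention `0 ln 0 = 0`. -/
def vonNeumannEntropy {d : ℕ} (ρ : Matrix (Fin d) (Fin d) ℂ) : ℝ :=
  -(ρ * cfc Real.log ρ).trace.re

/-- The rank-one projector `|ψ⟩⟨ψ|` (a pure state when `ψ` is a unit vector). -/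
def ketbra {d : ℕ} (ψ : Fin d → ℂ) : Matrix (Fin d) (Fin d) ℂ :=
  Matrix.vecMulVec ψ (star ψ)

/-- The maximally mixed state `𝕀 / d`. -/
def maximallyMixed (d : ℕ) : Matrix (Fin d) (Fin d) ℂ :=
  (d : ℂ)⁻¹ • (1 : Matrix (Fin d) (Fin d) ℂ)

/-- The dissipator `D[L]ρ = L ρ Lᴴ - ½ {Lᴴ L, ρ}`. -/
def dissipator {d : ℕ} (L ρ : Matrix (Fin d) (Fin d) ℂ) : Matrix (Fin d) (Fin d) ℂ :=
  L * ρ * Lᴴ - (1 / 2 : ℂ) • (Lᴴ * L * ρ + ρ * (Lᴴ * L))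

/-- The Lindblad generator `-i [H, ρ] + ∑ₖ D[Lₖ]ρ`. -/
def lindbladian {d : ℕ} {κ : Type*} [Fintype κ] (H : Matrix (Fin d) (Fin d) ℂ)
    (L : κ → Matrix (Fin d) (Fin d) ℂ) (ρ : Matrix (Fin d) (Fin d) ℂ) :
    Matrix (Fin d) (Fin d) ℂ :=
  (-Complex.I) • (H * ρ - ρ * H) + ∑ k, dissipator (L k) ρ

/-- A time-dependent matrix with (almost everywhere) measurable and bounded entries on `[0, τ]`.
Every continuous or piecewise continuous protocol, with finite jumps, is of this kind. -/
def IsBoundedMeasurable {d : ℕ} (τ : ℝ) (A : ℝ → Matrix (Fin d) (Fin d) ℂ) : Prop :=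
  (∀ i j, AEMeasurable (fun t => A t i j) (MeasureTheory.volume.restrict (Set.Icc 0 τ))) ∧
    ∃ C : ℝ, ∀ t ∈ Set.Icc 0 τ, ∀ i j, ‖A t i j‖ ≤ C

/-- Detailed balance at inverse temperature `β` on `[0, τ]`: each jump operator `Lₖ(t)` changes the
energy by a definite amount `ωₖ(t)`, that is `[Lₖ(t), H_t] = ωₖ(t) Lₖ(t)`, and it is paired with a
reversed jump operator `Lₖ'(t)`, where `k ↦ k'` is an involution of the set of channels, such that
`Lₖ(t) = exp (β ωₖ(t) / 2) Lₖ'(t)ᴴ`. -/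
def DetailedBalance {d : ℕ} {κ : Type*} (β τ : ℝ) (H : ℝ → Matrix (Fin d) (Fin d) ℂ)
    (L : κ → ℝ → Matrix (Fin d) (Fin d) ℂ) : Prop :=
  ∃ (ω : κ → ℝ → ℝ) (rev : κ → κ), Function.Involutive rev ∧
    ∀ t ∈ Set.Icc 0 τ, ∀ k,
      L k t * H t - H t * L k t = (ω k t : ℂ) • L k t ∧
      L k t = (Real.exp (β * ω k t / 2) : ℂ) • (L (rev k) t)ᴴ

/-- `ρ` solves the Lindblad equation `dρ_t/dt = -i [H_t, ρ_t] + ∑ₖ D[Lₖ(t)] ρ_t` on `[0, τ]`, in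
integrated form, so that the protocol may have discontinuities. -/
def IsLindbladSolution {d : ℕ} {κ : Type*} [Fintype κ] (τ : ℝ)
    (H : ℝ → Matrix (Fin d) (Fin d) ℂ) (L : κ → ℝ → Matrix (Fin d) (Fin d) ℂ)
    (ρ : ℝ → Matrix (Fin d) (Fin d) ℂ) : Prop :=
  ContinuousOn ρ (Set.Icc 0 τ) ∧
    ∀ t ∈ Set.Icc 0 τ, ∀ i j,
      ρ t i j = ρ 0 i j + ∫ s in (0 : ℝ)..t, lindbladian (H s) (fun k => L k s) (ρ s) i j

/-- The heat `Q = -∫₀^τ Tr (H_t dρ_t/dt) dt` dissipated into the bath. -/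
def dissipatedHeat {d : ℕ} (τ : ℝ) (H ρ : ℝ → Matrix (Fin d) (Fin d) ℂ) : ℝ :=
  -∫ t in (0 : ℝ)..τ, (H t * Matrix.of fun i j => deriv (fun s => ρ s i j) t).trace.re

/-- The time-averaged dynamical activity `τ⁻¹ ∫₀^τ ∑ₖ Tr (ρ_t Lₖ(t)ᴴ Lₖ(t)) dt`. -/
def meanActivity {d : ℕ} {κ : Type*} [Fintype κ] (τ : ℝ)
    (L : κ → ℝ → Matrix (Fin d) (Fin d) ℂ) (ρ : ℝ → Matrix (Fin d) (Fin d) ℂ) : ℝ :=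
  τ⁻¹ * ∫ t in (0 : ℝ)..τ, ∑ k, (ρ t * (L k t)ᴴ * L k t).trace.re

/-- The entropy decrease `ΔS = S(ρ_0) - S(ρ_τ)`. -/
def entropyDecrease {d : ℕ} (τ : ℝ) (ρ : ℝ → Matrix (Fin d) (Fin d) ℂ) : ℝ :=
  vonNeumannEntropy (ρ 0) - vonNeumannEntropy (ρ τ)

end

end QuantumLandauer

/-! A fraction with the activity in the denominator is a Legendre transform: it suffices to show,
for every `l ≥ 0`, that `ΔS + l ‖ρ₀ - ρ_τ‖₁ ≤ β Q + (l² / 2) τ γ̄`, and then to choose the best `l`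
(`entropyDecrease_add_mul_traceNorm_le`).

The left side is a single spectral quantity. Since `ρ₀ = 𝕀 / d` is a multiple of the identity,
`-S(ρ_t) + l ‖ρ₀ - ρ_t‖₁ = Tr φ(ρ_t)` with the convex function `φ(x) = x log x + l |x - 1/d|`.
Klein's inequality makes this Lipschitz in time and identifies its derivative, almost everywhere, as
`Tr (ρ̇_t ψ(ρ_t))` for a subgradient `ψ` of `φ` (`trace_cfc_sub_le_integral`); no derivative of an
eigenvalue is taken.

In an eigenbasis of `ρ_t` the generator acts on functions of `ρ_t` as a classical jump process: the
Hamiltonian part drops out, and channel `k` carries the flow `a = w p_j` from `j` to `i`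
(`trace_lindbladian_mul_cfc`). Detailed balance pairs it with a reverse flow `b`, and `log a - log b
= β ω + log p_j - log p_i` is the entropy production per jump. The scalar bound `(a - b)(log a - log
b) ≥ 2 (a - b)² / (a + b)` and a completed square (`affinity_tradeoff`) then bound the rate by heat
plus `l² / 2` times activity (`trace_lindbladian_mul_cfc_le`).

The logarithm requires the spectrum to stay away from `0`. Hermiticity and strict positivity of
`ρ_t` are not assumed; both follow from the equation by Grönwall arguments
(`IsLindbladSolution.isHermitian`, `IsLindbladSolution.spectrum_subset_Ici`). -/

namespace QuantumLandauer

/-! ### Spectral double sums and Klein's inequality -/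

section Spectral

variable {n : Type*} [Fintype n] [DecidableEq n] {A B : Matrix n n ℂ}

/-- The squared modulus `|⟨bᵢ|X|aⱼ⟩|²` of the matrix element of `X` between eigenvectors of the
Hermitian matrices `A` and `B`. -/
noncomputable def transitionWeight (hA : A.IsHermitian) (hB : B.IsHermitian) (X : Matrix n n ℂ)
    (i j : n) : ℝ :=
  ‖((hB.eigenvectorUnitary : Matrix n n ℂ)ᴴ * X * (hA.eigenvectorUnitary : Matrix n n ℂ)) i j‖ ^ 2

lemma transitionWeight_nonneg (hA : A.IsHermitian) (hB : B.IsHermitian) (X : Matrix n n ℂ)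
    (i j : n) : 0 ≤ transitionWeight hA hB X i j := sq_nonneg _

lemma cfc_eq_conj (hA : A.IsHermitian) (f : ℝ → ℝ) :
    cfc f A = (hA.eigenvectorUnitary : Matrix n n ℂ) *
      Matrix.diagonal (fun i => (f (hA.eigenvalues i) : ℂ)) *
      (hA.eigenvectorUnitary : Matrix n n ℂ)ᴴ := by
  rw [hA.cfc_eq, Matrix.IsHermitian.cfc, Unitary.conjStarAlgAut_apply]
  rfl

lemma conjTranspose_eigenvectorUnitary_mul_self (hA : A.IsHermitian) :
    (hA.eigenvectorUnitary : Matrix n n ℂ)ᴴ * (hA.eigenvectorUnitary : Matrix n n ℂ) = 1 :=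
  Unitary.coe_star_mul_self hA.eigenvectorUnitary

lemma eigenvectorUnitary_mul_conjTranspose_self (hA : A.IsHermitian) :
    (hA.eigenvectorUnitary : Matrix n n ℂ) * (hA.eigenvectorUnitary : Matrix n n ℂ)ᴴ = 1 :=
  Unitary.coe_mul_star_self hA.eigenvectorUnitary

lemma cfc_one_eq_one (hA : A.IsHermitian) : cfc (fun _ : ℝ => (1 : ℝ)) A = 1 := by
  rw [cfc_eq_conj hA]
  simp [eigenvectorUnitary_mul_conjTranspose_self]

lemma cfc_self_eq (hA : A.IsHermitian) : cfc (fun x : ℝ => x) A = A :=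
  cfc_id' ℝ A hA

lemma cfc_mul_cfc (hA : A.IsHermitian) (f g : ℝ → ℝ) :
    cfc f A * cfc g A = cfc (fun x => f x * g x) A := by
  have := conjTranspose_eigenvectorUnitary_mul_self hA
  rw [cfc_eq_conj hA, cfc_eq_conj hA, cfc_eq_conj hA]
  set U := (hA.eigenvectorUnitary : Matrix n n ℂ)
  calc _ = U * (Matrix.diagonal (fun i => (f (hA.eigenvalues i) : ℂ)) * (Uᴴ * U) *
        Matrix.diagonal (fun i => (g (hA.eigenvalues i) : ℂ))) * Uᴴ := by
          simp only [Matrix.mul_assoc]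
    _ = _ := by
      rw [this, Matrix.mul_one, Matrix.diagonal_mul_diagonal]
      simp

lemma cfc_conjTranspose (f : ℝ → ℝ) : (cfc f A)ᴴ = cfc f A :=
  (cfc_predicate (R := ℝ) (p := IsSelfAdjoint) f A).star_eq

/-- Passing to both eigenbases turns the trace into a double sum with nonnegative weights. This is
the device that reduces the matrix inequalities below to scalar ones. -/
lemma trace_conj_cfc (hA : A.IsHermitian) (hB : B.IsHermitian) (X : Matrix n n ℂ) (f g : ℝ → ℝ) :
    (X * cfc f A * Xᴴ * cfc g B).trace =
      ((∑ i, ∑ j, transitionWeight hA hB X i j * (f (hA.eigenvalues j) * g (hB.eigenvalues i)) :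
        ℝ) : ℂ) := by
  rw [cfc_eq_conj hA, cfc_eq_conj hB]
  unfold transitionWeight
  set U := (hA.eigenvectorUnitary : Matrix n n ℂ)
  set V := (hB.eigenvectorUnitary : Matrix n n ℂ)
  set F := Matrix.diagonal (fun i => (f (hA.eigenvalues i) : ℂ))
  set G := Matrix.diagonal (fun i => (g (hB.eigenvalues i) : ℂ))
  have h : (X * (U * F * Uᴴ) * Xᴴ * (V * G * Vᴴ)).trace =
      ((Vᴴ * X * U) * F * (Vᴴ * X * U)ᴴ * G).trace := by
    rw [← Matrix.mul_assoc, ← Matrix.mul_assoc, Matrix.trace_mul_comm _ Vᴴ]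
    simp only [Matrix.conjTranspose_mul, Matrix.conjTranspose_conjTranspose, Matrix.mul_assoc]
  rw [h]
  set Y := Vᴴ * X * U
  rw [Matrix.trace]
  push_cast
  refine Finset.sum_congr rfl fun i _ => ?_
  rw [Matrix.diag_apply, Matrix.mul_diagonal, Matrix.mul_apply, Finset.sum_mul]
  refine Finset.sum_congr rfl fun j _ => ?_
  rw [Matrix.mul_diagonal, Matrix.conjTranspose_apply, ← Complex.mul_conj', starRingEnd_apply]
  ring

lemma transitionWeight_one_sum (hA : A.IsHermitian) (f : ℝ → ℝ) :
    ∑ i, ∑ j, transitionWeight hA hA 1 i j * f (hA.eigenvalues j) =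
      ∑ j, f (hA.eigenvalues j) := by
  refine Finset.sum_congr rfl fun i _ => ?_
  unfold transitionWeight
  rw [Matrix.mul_one, conjTranspose_eigenvectorUnitary_mul_self]
  rw [Finset.sum_eq_single i (fun j _ hj => by simp [hj.symm]) (by simp)]
  simp

lemma trace_cfc (hA : A.IsHermitian) (f : ℝ → ℝ) :
    (cfc f A).trace = ((∑ i, f (hA.eigenvalues i) : ℝ) : ℂ) := by
  have h := trace_conj_cfc hA hA 1 f (fun _ => 1)
  rw [cfc_one_eq_one hA] at h
  simpa [transitionWeight_one_sum] using h

lemma trace_mul_cfc (hA : A.IsHermitian) (f : ℝ → ℝ) :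
    (A * cfc f A).trace = ((∑ i, hA.eigenvalues i * f (hA.eigenvalues i) : ℝ) : ℂ) := by
  rw [← trace_cfc hA (fun x => x * f x), ← cfc_mul_cfc hA, cfc_self_eq hA]

/-- **Klein's inequality**: if `ψ` is a subgradient of `φ` on a set containing the spectra of the
Hermitian matrices `A` and `B`, then `Tr φ(B) + Tr ((A - B) ψ(B)) ≤ Tr φ(A)`. -/
lemma klein_inequality (hA : A.IsHermitian) (hB : B.IsHermitian) {I : Set ℝ} {φ ψ : ℝ → ℝ}
    (hφ : ∀ x ∈ I, ∀ y ∈ I, φ y + (x - y) * ψ y ≤ φ x)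
    (hAI : ∀ i, hA.eigenvalues i ∈ I) (hBI : ∀ i, hB.eigenvalues i ∈ I) :
    ∑ i, φ (hB.eigenvalues i) + ((A - B) * cfc ψ B).trace.re ≤ ∑ i, φ (hA.eigenvalues i) := by
  have key := fun f g => trace_conj_cfc hA hB 1 f g
  have h1 : ((cfc φ A).trace).re = ∑ i, ∑ j, transitionWeight hA hB 1 i j *
      φ (hA.eigenvalues j) := by
    have := key φ (fun _ => 1)
    rw [cfc_one_eq_one hB] at this
    simp only [Matrix.conjTranspose_one, Matrix.one_mul, Matrix.mul_one] at this
    rw [this, Complex.ofReal_re]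
    simp
  have h2 : ((cfc φ B).trace).re = ∑ i, ∑ j, transitionWeight hA hB 1 i j *
      φ (hB.eigenvalues i) := by
    have := key (fun _ => 1) φ
    rw [cfc_one_eq_one hA] at this
    simp only [Matrix.conjTranspose_one, Matrix.one_mul, Matrix.mul_one] at this
    rw [this, Complex.ofReal_re]
    simp
  have h3 : (A * cfc ψ B).trace.re = ∑ i, ∑ j, transitionWeight hA hB 1 i j *
      (hA.eigenvalues j * ψ (hB.eigenvalues i)) := by
    have := key (fun x => x) ψ
    rw [cfc_self_eq hA] at this
    simp only [Matrix.conjTranspose_one, Matrix.one_mul, Matrix.mul_one] at this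
    rw [this, Complex.ofReal_re]
  have h4 : (B * cfc ψ B).trace.re = ∑ i, ∑ j, transitionWeight hA hB 1 i j *
      (hB.eigenvalues i * ψ (hB.eigenvalues i)) := by
    have := key (fun _ => 1) (fun x => x * ψ x)
    rw [cfc_one_eq_one hA, ← cfc_mul_cfc hB, cfc_self_eq hB] at this
    simp only [Matrix.conjTranspose_one, Matrix.one_mul, Matrix.mul_one] at this
    rw [this, Complex.ofReal_re]
    simp
  rw [← Complex.ofReal_re (∑ i, φ (hB.eigenvalues i)), ← trace_cfc hB,
    ← Complex.ofReal_re (∑ i, φ (hA.eigenvalues i)), ← trace_cfc hA, Matrix.sub_mul,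
    Matrix.trace_sub, Complex.sub_re, h1, h2, h3, h4, ← Finset.sum_sub_distrib,
    ← Finset.sum_add_distrib]
  -- Every term is now an average over the same weights, so the scalar subgradient inequality can be
  -- applied pair by pair.
  refine Finset.sum_le_sum fun i _ => ?_
  rw [← Finset.sum_sub_distrib, ← Finset.sum_add_distrib]
  refine Finset.sum_le_sum fun j _ => ?_
  have := mul_le_mul_of_nonneg_left (hφ _ (hAI j) _ (hBI i)) (transitionWeight_nonneg hA hB 1 i j)
  linarith

lemma norm_cfc_apply_le (hA : A.IsHermitian) {ψ : ℝ → ℝ} {M : ℝ}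
    (hψ : ∀ i, |ψ (hA.eigenvalues i)| ≤ M) (i j : n) :
    ‖cfc ψ A i j‖ ≤ Fintype.card n * M := by
  rw [cfc_eq_conj hA, Matrix.mul_apply]
  refine (norm_sum_le _ _).trans ?_
  rw [← nsmul_eq_mul, ← Finset.card_univ, ← Finset.sum_const]
  refine Finset.sum_le_sum fun k _ => ?_
  rw [Matrix.mul_diagonal, Matrix.conjTranspose_apply, norm_mul, norm_mul, norm_star,
    Complex.norm_real, Real.norm_eq_abs]
  have h1 := entry_norm_bound_of_unitary hA.eigenvectorUnitary.2 i k
  have h2 := entry_norm_bound_of_unitary hA.eigenvectorUnitary.2 j k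
  have h3 := hψ k
  have h4 := abs_nonneg (ψ (hA.eigenvalues k))
  calc _ ≤ 1 * M * 1 := by gcongr; linarith
    _ = M := by ring

omit [DecidableEq n] in
lemma abs_trace_mul_re_le (X Y : Matrix n n ℂ) {M : ℝ} (hY : ∀ i j, ‖Y i j‖ ≤ M) :
    |(X * Y).trace.re| ≤ M * ∑ i, ∑ j, ‖X i j‖ := by
  refine (Complex.abs_re_le_norm _).trans ?_
  rw [Matrix.trace, Finset.mul_sum]
  refine (norm_sum_le _ _).trans (Finset.sum_le_sum fun i _ => ?_)
  rw [Matrix.diag_apply, Matrix.mul_apply, Finset.mul_sum]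
  refine (norm_sum_le _ _).trans (Finset.sum_le_sum fun j _ => ?_)
  rw [norm_mul, mul_comm]
  exact mul_le_mul_of_nonneg_right (hY _ _) (norm_nonneg _)

end Spectral

/-! ### The trace norm of Hermitian matrices -/

section TraceNorm

variable {d : ℕ} {A B : Matrix (Fin d) (Fin d) ℂ}

lemma cfc_sqrt_cfc_sq (hA : A.IsHermitian) (f : ℝ → ℝ) :
    cfc Real.sqrt (cfc f A * cfc f A) = cfc (fun x => |f x|) A := by
  rw [cfc_mul_cfc hA]
  have hf : ContinuousOn (fun x => f x * f x) (spectrum ℝ A) :=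
    A.finite_real_spectrum.continuousOn _
  have := cfc_comp' Real.sqrt (fun x => f x * f x) A (by fun_prop) hf hA
  refine this.symm.trans ?_
  simp [Real.sqrt_mul_self_eq_abs]

lemma traceNorm_cfc (hA : A.IsHermitian) (f : ℝ → ℝ) :
    traceNorm (cfc f A) = ∑ i, |f (hA.eigenvalues i)| := by
  rw [traceNorm, cfc_conjTranspose, cfc_sqrt_cfc_sq hA, trace_cfc hA, Complex.ofReal_re]

lemma traceNorm_eq_sum_abs_eigenvalues (hA : A.IsHermitian) :
    traceNorm A = ∑ i, |hA.eigenvalues i| := by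
  conv_lhs => rw [← cfc_self_eq hA]
  rw [traceNorm_cfc hA]

/-- A multiple of the identity commutes with `A`, so the distance to it depends only on the
eigenvalues. This is where a maximally mixed initial state is essential. -/
lemma traceNorm_smul_one_sub (hA : A.IsHermitian) (c : ℝ) :
    traceNorm ((c : ℂ) • 1 - A) = ∑ i, |c - hA.eigenvalues i| := by
  have : (c : ℂ) • 1 - A = cfc (fun x => c - x) A := by
    have hU := eigenvectorUnitary_mul_conjTranspose_self hA
    conv_lhs => rw [← cfc_self_eq hA]
    rw [cfc_eq_conj hA, cfc_eq_conj hA]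
    set U := (hA.eigenvectorUnitary : Matrix (Fin d) (Fin d) ℂ)
    have : Matrix.diagonal (fun i => ((c - hA.eigenvalues i : ℝ) : ℂ)) =
        (c : ℂ) • 1 - Matrix.diagonal (fun i => (hA.eigenvalues i : ℂ)) := by
      rw [Matrix.smul_one_eq_diagonal, Matrix.diagonal_sub]
      simp
    rw [this, Matrix.mul_sub, Matrix.sub_mul, Matrix.mul_smul, Matrix.mul_one, Matrix.smul_mul, hU]
  rw [this, traceNorm_cfc hA]

lemma traceNorm_neg (A : Matrix (Fin d) (Fin d) ℂ) : traceNorm (-A) = traceNorm A := by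
  simp [traceNorm]

lemma traceNorm_sub_comm (A B : Matrix (Fin d) (Fin d) ℂ) :
    traceNorm (A - B) = traceNorm (B - A) := by
  rw [← traceNorm_neg, neg_sub]

lemma traceNorm_nonneg (hA : A.IsHermitian) : 0 ≤ traceNorm A := by
  rw [traceNorm_eq_sum_abs_eigenvalues hA]
  exact Finset.sum_nonneg fun _ _ => abs_nonneg _

/-- `x ↦ sign x` is a subgradient of the absolute value. -/
lemma abs_add_mul_sign_le (x y : ℝ) : |y| + (x - y) * SignType.sign y ≤ |x| := by
  rcases lt_trichotomy y 0 with h | rfl | h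
  · simp only [h, abs_of_neg h, sign_neg, SignType.coe_neg_one]
    linarith [neg_le_abs x]
  · simp
  · simp [h, abs_of_pos h, le_abs_self]

/-- Half of trace norm duality: in Klein's inequality for `|x|` the term `Tr |B|` cancels `Tr (B
sign B)`. Testing against `sign (A + B)` then gives the triangle inequality. -/
lemma mul_cfc_sign_trace_le (hA : A.IsHermitian) (hB : B.IsHermitian) :
    (A * cfc (fun x => (SignType.sign x : ℝ)) B).trace.re ≤ traceNorm A := by
  have h := klein_inequality hA hB (I := Set.univ) (φ := fun x => |x|)
    (ψ := fun x => (SignType.sign x : ℝ)) (fun x _ y _ => abs_add_mul_sign_le x y)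
    (fun _ => trivial) (fun _ => trivial)
  have hs : (B * cfc (fun x => (SignType.sign x : ℝ)) B).trace.re =
      ∑ i, |hB.eigenvalues i| := by
    rw [trace_mul_cfc hB, Complex.ofReal_re]
    simp
  rw [Matrix.sub_mul, Matrix.trace_sub, Complex.sub_re, hs] at h
  rw [traceNorm_eq_sum_abs_eigenvalues hA]
  linarith

lemma traceNorm_add_le (hA : A.IsHermitian) (hB : B.IsHermitian) :
    traceNorm (A + B) ≤ traceNorm A + traceNorm B := by
  have hC : (A + B).IsHermitian := hA.add hB
  have h1 := mul_cfc_sign_trace_le hA hC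
  have h2 := mul_cfc_sign_trace_le hB hC
  have hs : ((A + B) * cfc (fun x => (SignType.sign x : ℝ)) (A + B)).trace.re =
      traceNorm (A + B) := by
    rw [trace_mul_cfc hC, Complex.ofReal_re, traceNorm_eq_sum_abs_eigenvalues hC]
    simp
  rw [← hs, Matrix.add_mul, Matrix.trace_add, Complex.add_re]
  linarith

lemma abs_traceNorm_sub_traceNorm_le (hA : A.IsHermitian) (hB : B.IsHermitian) :
    |traceNorm A - traceNorm B| ≤ traceNorm (A - B) := by
  have h1 := traceNorm_add_le (hA.sub hB) hB
  have h2 := traceNorm_add_le (hB.sub hA) hA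
  rw [sub_add_cancel] at h1 h2
  rw [traceNorm_sub_comm B A] at h2
  rw [abs_le]
  constructor <;> linarith

lemma ketbra_isHermitian (ψ : Fin d → ℂ) : (ketbra ψ).IsHermitian := by
  ext i j
  simp [ketbra, Matrix.vecMulVec_apply, mul_comm]

lemma ketbra_mul_self {ψ : Fin d → ℂ} (hψ : star ψ ⬝ᵥ ψ = 1) :
    ketbra ψ * ketbra ψ = ketbra ψ := by
  simp [ketbra, Matrix.vecMulVec_mul_vecMulVec, hψ]

lemma ketbra_trace {ψ : Fin d → ℂ} (hψ : star ψ ⬝ᵥ ψ = 1) : (ketbra ψ).trace = 1 := by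
  rw [ketbra, Matrix.trace_vecMulVec, dotProduct_comm, hψ]

lemma eigenvalues_eq_zero_or_one (hA : A.IsHermitian) (h : A * A = A) (i : Fin d) :
    hA.eigenvalues i = 0 ∨ hA.eigenvalues i = 1 := by
  have h1 := hA.mulVec_eigenvectorBasis i
  have h2 : A *ᵥ (A *ᵥ (hA.eigenvectorBasis i)) = A *ᵥ (hA.eigenvectorBasis i) := by
    rw [Matrix.mulVec_mulVec, h]
  have hne : (hA.eigenvectorBasis i).ofLp ≠ 0 := by
    intro h0
    exact hA.eigenvectorBasis.orthonormal.ne_zero i (by ext j; simpa using congrFun h0 j)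
  rw [h1, Matrix.mulVec_smul, h1, smul_smul, ← sub_eq_zero, ← sub_smul] at h2
  rcases smul_eq_zero.mp h2 with h3 | h3
  · have : hA.eigenvalues i * (hA.eigenvalues i - 1) = 0 := by linarith
    rcases mul_eq_zero.mp this with h4 | h4
    · exact Or.inl h4
    · exact Or.inr (by linarith)
  · exact absurd h3 hne

lemma traceNorm_maximallyMixed_sub_ketbra {ψ : Fin d → ℂ} (hψ : star ψ ⬝ᵥ ψ = 1) :
    traceNorm (maximallyMixed d - ketbra ψ) = 2 * (1 - 1 / (d : ℝ)) := by
  have hd : 0 < d := by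
    rcases Nat.eq_zero_or_pos d with rfl | h
    · simp at hψ
    · exact h
  have hd1 : (1 : ℝ) ≤ d := by exact_mod_cast hd
  have hP := ketbra_isHermitian ψ
  have hc : maximallyMixed d = (((d : ℝ)⁻¹ : ℝ) : ℂ) • 1 := by simp [maximallyMixed]
  have htr := hP.trace_eq_sum_eigenvalues
  rw [ketbra_trace hψ] at htr
  have htr' : ∑ i, hP.eigenvalues i = 1 := by
    have := congrArg Complex.re htr
    simpa using this.symm
  rw [hc, traceNorm_smul_one_sub hP]
  -- On the values `0` and `1` the absolute value agrees with an affine function, so the sum needs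
  -- only the trace of the projector.
  have : ∀ i, |(d : ℝ)⁻¹ - hP.eigenvalues i| =
      (d : ℝ)⁻¹ + (1 - 2 * (d : ℝ)⁻¹) * hP.eigenvalues i := by
    intro i
    have h1 : (d : ℝ)⁻¹ ≤ 1 := inv_le_one_of_one_le₀ hd1
    rcases eigenvalues_eq_zero_or_one hP (ketbra_mul_self hψ) i with h | h
    · rw [h, sub_zero, abs_of_nonneg (by positivity)]; ring
    · rw [h, abs_of_nonpos (by linarith)]; ring
  simp only [this, Finset.sum_add_distrib, ← Finset.mul_sum, htr']
  have : (d : ℝ) ≠ 0 := by positivity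
  simp
  field_simp
  ring

end TraceNorm

open MeasureTheory Set

/-! ### Spectral functions along Lipschitz paths, and Grönwall -/

section Calculus

lemma hasDerivAt_trace_mul_re {n : Type*} [Fintype n] {A : ℝ → Matrix n n ℂ} {A' : Matrix n n ℂ}
    {t : ℝ} (hA : ∀ i j, HasDerivAt (fun s => A s i j) (A' i j) t) (Y : Matrix n n ℂ) :
    HasDerivAt (fun s => (A s * Y).trace.re) (A' * Y).trace.re t := by
  have h : HasDerivAt (fun s => (A s * Y).trace) (A' * Y).trace t := by
    simp only [Matrix.trace, Matrix.diag_apply, Matrix.mul_apply]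
    exact HasDerivAt.fun_sum fun i _ => HasDerivAt.fun_sum fun j _ => (hA i j).mul_const _
  exact (Complex.reCLM.hasFDerivAt).comp_hasDerivAt t h

section LipschitzPath

variable {n : Type*} [Fintype n] [DecidableEq n] {T K M : ℝ} {A : ℝ → Matrix n n ℂ} {I : Set ℝ}
  {φ ψ : ℝ → ℝ}

/-- Supporting hyperplane at time `t`. It gives the Lipschitz bound once `s` and `t` are exchanged,
and the derivative once `s` tends to `t`. -/
lemma trace_cfc_add_le (hA : ∀ t ∈ Icc 0 T, (A t).IsHermitian)
    (hI : ∀ t ∈ Icc 0 T, spectrum ℝ (A t) ⊆ I) (hφ : ∀ x ∈ I, ∀ y ∈ I, φ y + (x - y) * ψ y ≤ φ x)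
    {s t : ℝ} (hs : s ∈ Icc 0 T) (ht : t ∈ Icc 0 T) :
    (cfc φ (A t)).trace.re + ((A s - A t) * cfc ψ (A t)).trace.re ≤ (cfc φ (A s)).trace.re := by
  have := klein_inequality (hA s hs) (hA t ht) hφ
    (fun i => hI s hs ((hA s hs).eigenvalues_mem_spectrum_real i))
    (fun i => hI t ht ((hA t ht).eigenvalues_mem_spectrum_real i))
  simpa only [trace_cfc (hA s hs), trace_cfc (hA t ht), Complex.ofReal_re] using this

lemma exists_lipschitzOnWith_trace_cfc (hA : ∀ t ∈ Icc 0 T, (A t).IsHermitian)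
    (hI : ∀ t ∈ Icc 0 T, spectrum ℝ (A t) ⊆ I) (hφ : ∀ x ∈ I, ∀ y ∈ I, φ y + (x - y) * ψ y ≤ φ x)
    (hψ : ∀ x ∈ I, |ψ x| ≤ M)
    (hLip : ∀ s ∈ Icc 0 T, ∀ t ∈ Icc 0 T, ∀ i j, ‖A s i j - A t i j‖ ≤ K * |s - t|) :
    ∃ C, LipschitzOnWith C (fun t => (cfc φ (A t)).trace.re) (Icc 0 T) := by
  set G : ℝ → ℝ := fun t => (cfc φ (A t)).trace.re with hG
  set C : ℝ := (Fintype.card n * |M|) * ∑ _i : n, ∑ _j : n, K with hC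
  have lower : ∀ s ∈ Icc 0 T, ∀ t ∈ Icc 0 T, G t - G s ≤ C * |s - t| := by
    intro s hs t ht
    have h1 := trace_cfc_add_le hA hI hφ hs ht
    have h2 := abs_trace_mul_re_le (A s - A t) (cfc ψ (A t)) (M := Fintype.card n * |M|)
      (norm_cfc_apply_le (hA t ht) fun i =>
        (hψ _ (hI t ht ((hA t ht).eigenvalues_mem_spectrum_real i))).trans (le_abs_self M))
    have h3 : ∑ i, ∑ j, ‖(A s - A t) i j‖ ≤ (∑ _i : n, ∑ _j : n, K) * |s - t| := by
      simp only [Finset.sum_mul]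
      exact Finset.sum_le_sum fun i _ => Finset.sum_le_sum fun j _ => hLip s hs t ht i j
    have h4 := mul_le_mul_of_nonneg_left h3 (by positivity : 0 ≤ Fintype.card n * |M|)
    have h5 := (abs_le.mp (h2.trans h4)).1
    rw [hC]
    linarith
  refine ⟨C.toNNReal, LipschitzOnWith.of_dist_le_mul fun s hs t ht => ?_⟩
  rw [Real.dist_eq, Real.dist_eq]
  refine le_trans ?_ (mul_le_mul_of_nonneg_right (Real.le_coe_toNNReal C) (abs_nonneg _))
  rw [abs_le]
  have h1 := lower s hs t ht
  have h2 := lower t ht s hs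
  rw [abs_sub_comm] at h2
  constructor <;> linarith

/-- Along a Lipschitz path of Hermitian matrices, the growth of `Tr φ(A)`, for `φ` with subgradient
`ψ`, is controlled by the integral of any bound of `Tr (A' ψ(A))`. -/
lemma trace_cfc_sub_le_integral (hT : 0 ≤ T) {A' : ℝ → Matrix n n ℂ} {h : ℝ → ℝ}
    (hA : ∀ t ∈ Icc 0 T, (A t).IsHermitian) (hI : ∀ t ∈ Icc 0 T, spectrum ℝ (A t) ⊆ I)
    (hφ : ∀ x ∈ I, ∀ y ∈ I, φ y + (x - y) * ψ y ≤ φ x) (hψ : ∀ x ∈ I, |ψ x| ≤ M)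
    (hLip : ∀ s ∈ Icc 0 T, ∀ t ∈ Icc 0 T, ∀ i j, ‖A s i j - A t i j‖ ≤ K * |s - t|)
    (hderiv : ∀ᵐ t, t ∈ Icc 0 T → ∀ i j, HasDerivAt (fun s => A s i j) (A' t i j) t)
    (hh : IntervalIntegrable h volume 0 T)
    (hle : ∀ t ∈ Icc 0 T, (A' t * cfc ψ (A t)).trace.re ≤ h t) :
    (cfc φ (A T)).trace.re - (cfc φ (A 0)).trace.re ≤ ∫ t in (0 : ℝ)..T, h t := by
  obtain ⟨C, hlip⟩ := exists_lipschitzOnWith_trace_cfc hA hI hφ hψ hLip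
  set G : ℝ → ℝ := fun t => (cfc φ (A t)).trace.re
  rw [← uIcc_of_le hT] at hlip
  have hac := hlip.absolutelyContinuousOnInterval
  change G T - G 0 ≤ _
  rw [← hac.integral_deriv_eq_sub]
  refine intervalIntegral.integral_mono_ae_restrict hT hac.intervalIntegrable_deriv hh ?_
  rw [Filter.EventuallyLE, ae_restrict_iff' measurableSet_Icc]
  filter_upwards [Measure.ae_ne volume 0, Measure.ae_ne volume T, hac.ae_differentiableAt, hderiv]
    with t ht0 htT hdiff hd ht
  rw [uIcc_of_le hT] at hdiff
  refine le_of_eq_of_le ?_ (hle t ht)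
  have hnhds : Icc 0 T ∈ nhds t :=
    Icc_mem_nhds (lt_of_le_of_ne ht.1 ht0.symm) (lt_of_le_of_ne ht.2 htT)
  -- The supporting hyperplane touches `G` from below at `t`, so the difference has a local minimum
  -- there. Its derivative vanishes, which gives `deriv G t` even though `φ` need not be
  -- differentiable.
  have hF : HasDerivAt (fun s => G s - (A s * cfc ψ (A t)).trace.re)
      (deriv G t - (A' t * cfc ψ (A t)).trace.re) t :=
    (hdiff ht).hasDerivAt.fun_sub (hasDerivAt_trace_mul_re (hd ht) _)
  have hmin : IsLocalMin (fun s => G s - (A s * cfc ψ (A t)).trace.re) t := by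
    filter_upwards [hnhds] with s hs
    have := trace_cfc_add_le hA hI hφ hs ht
    rw [Matrix.sub_mul, Matrix.trace_sub, Complex.sub_re] at this
    linarith
  linarith [hmin.hasDerivAt_eq_zero hF]

end LipschitzPath

/-- Integral form of Grönwall's inequality with zero initial value. -/
lemma nonpos_of_le_mul_integral {u : ℝ → ℝ} {T K : ℝ} (hK : 0 ≤ K) (hu : ContinuousOn u (Icc 0 T))
    (h : ∀ t ∈ Icc 0 T, u t ≤ K * ∫ s in (0 : ℝ)..t, u s) : ∀ t ∈ Icc 0 T, u t ≤ 0 := by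
  intro t ht
  have hT : 0 ≤ T := ht.1.trans ht.2
  -- The continuous extension, constant beyond the endpoints, makes the primitive differentiable
  -- everywhere; Grönwall is applied to this primitive, whose derivative is at most `K` times
  -- itself.
  set v : ℝ → ℝ := IccExtend hT ((Icc 0 T).domRestrict u) with hv
  have hvc : Continuous v := hu.domRestrict.Icc_extend'
  have hvu : ∀ s ∈ Icc 0 T, v s = u s := fun s hs => by
    rw [hv, IccExtend_of_mem _ _ hs]; rfl
  have hint : ∀ s ∈ Icc 0 T, ∫ r in (0 : ℝ)..s, v r = ∫ r in (0 : ℝ)..s, u r := by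
    intro s hs
    refine intervalIntegral.integral_congr fun r hr => ?_
    rw [uIcc_of_le hs.1] at hr
    exact hvu r ⟨hr.1, hr.2.trans hs.2⟩
  have hder : ∀ x, HasDerivAt (fun s => ∫ r in (0 : ℝ)..s, v r) (v x) x := fun x =>
    (hvc.integral_hasStrictDerivAt 0 x).hasDerivAt
  have hU := le_gronwallBound_of_liminf_deriv_right_le (f := fun s => ∫ r in (0 : ℝ)..s, v r)
    (f' := v) (δ := 0) (K := K) (ε := 0) (a := 0) (b := T)
    (fun x _ => (hder x).continuousAt.continuousWithinAt)
    (fun x _ r hr => by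
      simpa [slope_def_field, div_eq_inv_mul] using
        (hder x).hasDerivWithinAt.liminf_right_slope_le hr)
    (by simp) (fun x hx => by
      have hx' : x ∈ Icc 0 T := ⟨hx.1, hx.2.le⟩
      rw [add_zero, hint x hx', hvu x hx']
      exact h x hx') t ht
  rw [gronwallBound_ε0_δ0, hint t ht] at hU
  exact (h t ht).trans (mul_nonpos_of_nonneg_of_nonpos hK hU)

end Calculus

/-! ### Bounded measurable matrix paths -/

section Regularity

variable {d : ℕ} {τ : ℝ} {A B : ℝ → Matrix (Fin d) (Fin d) ℂ}

lemma IsBoundedMeasurable.add (hA : IsBoundedMeasurable τ A) (hB : IsBoundedMeasurable τ B) :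
    IsBoundedMeasurable τ (fun t => A t + B t) := by
  obtain ⟨hA1, C, hA2⟩ := hA
  obtain ⟨hB1, D, hB2⟩ := hB
  exact ⟨fun i j => (hA1 i j).add (hB1 i j), C + D, fun t ht i j =>
    (norm_add_le _ _).trans (add_le_add (hA2 t ht i j) (hB2 t ht i j))⟩

lemma IsBoundedMeasurable.const_smul (c : ℂ) (hA : IsBoundedMeasurable τ A) :
    IsBoundedMeasurable τ (fun t => c • A t) := by
  obtain ⟨hA1, C, hA2⟩ := hA
  refine ⟨fun i j => (hA1 i j).const_mul c, ‖c‖ * C, fun t ht i j => ?_⟩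
  simp only [Matrix.smul_apply, norm_smul]
  exact mul_le_mul_of_nonneg_left (hA2 t ht i j) (norm_nonneg c)

lemma IsBoundedMeasurable.sub (hA : IsBoundedMeasurable τ A) (hB : IsBoundedMeasurable τ B) :
    IsBoundedMeasurable τ (fun t => A t - B t) := by
  simpa [sub_eq_add_neg] using hA.add (hB.const_smul (-1))

lemma IsBoundedMeasurable.mul (hA : IsBoundedMeasurable τ A) (hB : IsBoundedMeasurable τ B) :
    IsBoundedMeasurable τ (fun t => A t * B t) := by
  obtain ⟨hA1, C, hA2⟩ := hA
  obtain ⟨hB1, D, hB2⟩ := hB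
  simp only [IsBoundedMeasurable, Matrix.mul_apply]
  refine ⟨fun i j => Finset.aemeasurable_fun_sum _ fun k _ => (hA1 i k).mul (hB1 k j),
    ∑ _k : Fin d, C * D, fun t ht i j => ?_⟩
  refine (norm_sum_le _ _).trans (Finset.sum_le_sum fun k _ => ?_)
  rw [norm_mul]
  exact mul_le_mul (hA2 t ht i k) (hB2 t ht k j) (norm_nonneg _)
    ((norm_nonneg _).trans (hA2 t ht i k))

lemma IsBoundedMeasurable.conjTranspose (hA : IsBoundedMeasurable τ A) :
    IsBoundedMeasurable τ (fun t => (A t)ᴴ) := by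
  obtain ⟨hA1, C, hA2⟩ := hA
  refine ⟨fun i j => ?_, C, fun t ht i j => ?_⟩
  · exact Complex.continuous_conj.measurable.comp_aemeasurable (hA1 j i)
  · simp only [Matrix.conjTranspose_apply, norm_star]
    exact hA2 t ht j i

lemma IsBoundedMeasurable.finsetSum {κ : Type*} (s : Finset κ)
    {F : κ → ℝ → Matrix (Fin d) (Fin d) ℂ} (hF : ∀ k, IsBoundedMeasurable τ (F k)) :
    IsBoundedMeasurable τ (fun t => ∑ k ∈ s, F k t) := by
  choose hF1 C hF2 using hF
  simp only [IsBoundedMeasurable, Matrix.sum_apply]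
  refine ⟨fun i j => Finset.aemeasurable_fun_sum _ fun k _ => hF1 k i j, ∑ k ∈ s, C k,
    fun t ht i j => ?_⟩
  exact (norm_sum_le _ _).trans (Finset.sum_le_sum fun k _ => hF2 k t ht i j)

lemma isBoundedMeasurable_of_continuousOn (hA : ContinuousOn A (Icc 0 τ)) :
    IsBoundedMeasurable τ A := by
  have h : ∀ i j, ContinuousOn (fun t => A t i j) (Icc 0 τ) := fun i j =>
    (continuous_id.matrix_elem i j).comp_continuousOn hA
  refine ⟨fun i j => (h i j).aemeasurable measurableSet_Icc, ?_⟩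
  choose C hC using fun i j => isCompact_Icc.exists_bound_of_continuousOn (h i j)
  refine ⟨∑ i, ∑ j, |C i j|, fun t ht i j => (hC i j t ht).trans ((le_abs_self _).trans ?_)⟩
  refine (Finset.single_le_sum (f := fun j => |C i j|) (fun _ _ => abs_nonneg _)
    (Finset.mem_univ j)).trans ?_
  exact Finset.single_le_sum (f := fun i => ∑ j, |C i j|)
    (fun _ _ => Finset.sum_nonneg fun _ _ => abs_nonneg _) (Finset.mem_univ i)

lemma IsBoundedMeasurable.mono {σ : ℝ} (hA : IsBoundedMeasurable τ A) (h : σ ≤ τ) :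
    IsBoundedMeasurable σ A :=
  ⟨fun i j => (hA.1 i j).mono_set (Icc_subset_Icc_right h), hA.2.imp fun _ hC t ht =>
    hC t ⟨ht.1, ht.2.trans h⟩⟩

lemma IsBoundedMeasurable.intervalIntegrable (hA : IsBoundedMeasurable τ A) (hτ : 0 ≤ τ)
    (i j : Fin d) : IntervalIntegrable (fun t => A t i j) volume 0 τ := by
  obtain ⟨hA1, C, hA2⟩ := hA
  rw [intervalIntegrable_iff_integrableOn_Icc_of_le hτ]
  exact Integrable.of_bound (hA1 i j).aestronglyMeasurable C
    ((ae_restrict_iff' measurableSet_Icc).mpr (Filter.Eventually.of_forall fun t ht =>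
      hA2 t ht i j))

lemma intervalIntegrable_fun_sum {ι E : Type*} [NormedAddCommGroup E] {s : Finset ι}
    {f : ι → ℝ → E} {a b : ℝ} (hf : ∀ i ∈ s, IntervalIntegrable (f i) volume a b) :
    IntervalIntegrable (fun t => ∑ i ∈ s, f i t) volume a b :=
  ⟨integrable_finsetSum s fun i hi => (hf i hi).1, integrable_finsetSum s fun i hi => (hf i hi).2⟩

lemma IsBoundedMeasurable.intervalIntegrable_trace_re (hA : IsBoundedMeasurable τ A) (hτ : 0 ≤ τ) :
    IntervalIntegrable (fun t => (A t).trace.re) volume 0 τ := by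
  simp only [Matrix.trace, Matrix.diag_apply, Complex.re_sum]
  refine intervalIntegrable_fun_sum fun i _ => ?_
  have h := hA.intervalIntegrable hτ i i
  exact ⟨h.1.re, h.2.re⟩

variable {κ : Type*} [Fintype κ] {H ρ : ℝ → Matrix (Fin d) (Fin d) ℂ}
  {L : κ → ℝ → Matrix (Fin d) (Fin d) ℂ}

lemma IsBoundedMeasurable.lindbladian (hH : IsBoundedMeasurable τ H)
    (hL : ∀ k, IsBoundedMeasurable τ (L k)) (hA : IsBoundedMeasurable τ A) :
    IsBoundedMeasurable τ (fun t => lindbladian (H t) (fun k => L k t) (A t)) := by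
  refine (((hH.mul hA).sub (hA.mul hH)).const_smul _).add (finsetSum _ fun k => ?_)
  have hN := (hL k).conjTranspose.mul (hL k)
  exact (((hL k).mul hA).mul (hL k).conjTranspose).sub
    (((hN.mul hA).add (hA.mul hN)).const_smul _)

end Regularity

/-! ### A submultiplicative norm bounding the generator -/

section EntryNorm

variable {d : ℕ}

/-- The entrywise `ℓ¹` norm of a matrix. -/
noncomputable def entryNorm (A : Matrix (Fin d) (Fin d) ℂ) : ℝ := ∑ i, ∑ j, ‖A i j‖

lemma entryNorm_nonneg (A : Matrix (Fin d) (Fin d) ℂ) : 0 ≤ entryNorm A :=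
  Finset.sum_nonneg fun _ _ => Finset.sum_nonneg fun _ _ => norm_nonneg _

lemma norm_apply_le_entryNorm (A : Matrix (Fin d) (Fin d) ℂ) (i j : Fin d) :
    ‖A i j‖ ≤ entryNorm A :=
  (Finset.single_le_sum (f := fun j => ‖A i j‖) (fun _ _ => norm_nonneg _)
    (Finset.mem_univ j)).trans (Finset.single_le_sum (f := fun i => ∑ j, ‖A i j‖)
    (fun _ _ => Finset.sum_nonneg fun _ _ => norm_nonneg _) (Finset.mem_univ i))

lemma entryNorm_add_le (A B : Matrix (Fin d) (Fin d) ℂ) :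
    entryNorm (A + B) ≤ entryNorm A + entryNorm B := by
  simp only [entryNorm, ← Finset.sum_add_distrib]
  exact Finset.sum_le_sum fun i _ => Finset.sum_le_sum fun j _ => norm_add_le _ _

lemma entryNorm_smul (c : ℂ) (A : Matrix (Fin d) (Fin d) ℂ) :
    entryNorm (c • A) = ‖c‖ * entryNorm A := by
  simp [entryNorm, Finset.mul_sum]

lemma entryNorm_sub_le (A B : Matrix (Fin d) (Fin d) ℂ) :
    entryNorm (A - B) ≤ entryNorm A + entryNorm B := by
  have h := entryNorm_add_le A ((-1 : ℂ) • B)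
  rw [entryNorm_smul] at h
  simpa [sub_eq_add_neg] using h

lemma entryNorm_sum_le {κ : Type*} (s : Finset κ) (F : κ → Matrix (Fin d) (Fin d) ℂ) :
    entryNorm (∑ k ∈ s, F k) ≤ ∑ k ∈ s, entryNorm (F k) :=
  Finset.le_sum_of_subadditive entryNorm (by simp [entryNorm]) entryNorm_add_le s F

lemma entryNorm_conjTranspose (A : Matrix (Fin d) (Fin d) ℂ) : entryNorm Aᴴ = entryNorm A := by
  simp only [entryNorm, Matrix.conjTranspose_apply, norm_star]
  exact Finset.sum_comm

lemma entryNorm_mul_le (A B : Matrix (Fin d) (Fin d) ℂ) :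
    entryNorm (A * B) ≤ entryNorm A * entryNorm B := by
  have h : ∀ i, ∑ j, ‖(A * B) i j‖ ≤ (∑ k, ‖A i k‖) * entryNorm B := by
    intro i
    have h1 : ∀ j, ‖(A * B) i j‖ ≤ ∑ k, ‖A i k‖ * ‖B k j‖ := fun j => by
      rw [Matrix.mul_apply]
      exact (norm_sum_le _ _).trans_eq (Finset.sum_congr rfl fun k _ => norm_mul _ _)
    refine (Finset.sum_le_sum fun j _ => h1 j).trans ?_
    rw [Finset.sum_comm, Finset.sum_mul]
    refine Finset.sum_le_sum fun k _ => ?_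
    rw [← Finset.mul_sum]
    exact mul_le_mul_of_nonneg_left (Finset.single_le_sum (f := fun k => ∑ j, ‖B k j‖)
      (fun _ _ => Finset.sum_nonneg fun _ _ => norm_nonneg _) (Finset.mem_univ k)) (norm_nonneg _)
  refine (Finset.sum_le_sum fun i _ => h i).trans_eq ?_
  rw [← Finset.sum_mul]
  rfl

lemma entryNorm_dissipator_le (L X : Matrix (Fin d) (Fin d) ℂ) :
    entryNorm (dissipator L X) ≤ 2 * entryNorm L ^ 2 * entryNorm X := by
  have hN : entryNorm (Lᴴ * L) ≤ entryNorm L ^ 2 := by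
    simpa [entryNorm_conjTranspose, sq] using entryNorm_mul_le Lᴴ L
  have h0 := entryNorm_nonneg L
  have hX := entryNorm_nonneg X
  have h1 : entryNorm (L * X * Lᴴ) ≤ entryNorm L ^ 2 * entryNorm X := by
    have := mul_le_mul_of_nonneg_right (entryNorm_mul_le L X) h0
    have := entryNorm_mul_le (L * X) Lᴴ
    rw [entryNorm_conjTranspose] at this
    nlinarith
  have h2 : entryNorm (Lᴴ * L * X) ≤ entryNorm L ^ 2 * entryNorm X :=
    (entryNorm_mul_le _ _).trans (mul_le_mul_of_nonneg_right hN hX)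
  have h3 : entryNorm (X * (Lᴴ * L)) ≤ entryNorm L ^ 2 * entryNorm X := by
    rw [mul_comm (_ ^ 2)]
    exact (entryNorm_mul_le _ _).trans (mul_le_mul_of_nonneg_left hN hX)
  have h4 := entryNorm_add_le (Lᴴ * L * X) (X * (Lᴴ * L))
  have h5 := entryNorm_sub_le (L * X * Lᴴ) ((1 / 2 : ℂ) • (Lᴴ * L * X + X * (Lᴴ * L)))
  rw [entryNorm_smul] at h5
  norm_num at h5
  rw [dissipator]
  norm_num
  linarith

lemma entryNorm_lindbladian_le {κ : Type*} [Fintype κ] (H : Matrix (Fin d) (Fin d) ℂ)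
    (L : κ → Matrix (Fin d) (Fin d) ℂ) (X : Matrix (Fin d) (Fin d) ℂ) :
    entryNorm (lindbladian H L X) ≤
      (2 * entryNorm H + ∑ k, 2 * entryNorm (L k) ^ 2) * entryNorm X := by
  rw [lindbladian, add_mul, Finset.sum_mul]
  refine (entryNorm_add_le _ _).trans (add_le_add ?_ ((entryNorm_sum_le _ _).trans
    (Finset.sum_le_sum fun k _ => entryNorm_dissipator_le _ _)))
  rw [entryNorm_smul]
  have h1 := entryNorm_sub_le (H * X) (X * H)
  have h2 := entryNorm_mul_le H X
  have h3 := entryNorm_mul_le X H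
  simp only [norm_neg, Complex.norm_I, one_mul]
  linarith

lemma IsBoundedMeasurable.exists_entryNorm_le {τ : ℝ} {A : ℝ → Matrix (Fin d) (Fin d) ℂ}
    (hA : IsBoundedMeasurable τ A) : ∃ C, ∀ t ∈ Icc 0 τ, entryNorm (A t) ≤ C := by
  obtain ⟨-, C, hC⟩ := hA
  exact ⟨∑ _i : Fin d, ∑ _j : Fin d, C, fun t ht =>
    Finset.sum_le_sum fun i _ => Finset.sum_le_sum fun j _ => hC t ht i j⟩

lemma IsBoundedMeasurable.intervalIntegrable_entryNorm {τ : ℝ}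
    {A : ℝ → Matrix (Fin d) (Fin d) ℂ} (hA : IsBoundedMeasurable τ A) (hτ : 0 ≤ τ) :
    IntervalIntegrable (fun t => entryNorm (A t)) volume 0 τ :=
  intervalIntegrable_fun_sum fun i _ => intervalIntegrable_fun_sum fun j _ =>
    (hA.intervalIntegrable hτ i j).norm

end EntryNorm

/-! ### Regularity, trace and Hermiticity of solutions -/

section Solution

variable {d : ℕ} {κ : Type*} [Fintype κ] {τ : ℝ} {H ρ : ℝ → Matrix (Fin d) (Fin d) ℂ}
  {L : κ → ℝ → Matrix (Fin d) (Fin d) ℂ}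

lemma dissipator_conjTranspose (L X : Matrix (Fin d) (Fin d) ℂ) :
    (dissipator L X)ᴴ = dissipator L Xᴴ := by
  simp only [dissipator, Matrix.conjTranspose_sub, Matrix.conjTranspose_mul,
    Matrix.conjTranspose_smul, Matrix.conjTranspose_add, Matrix.conjTranspose_conjTranspose,
    Matrix.mul_assoc]
  rw [add_comm (Xᴴ * _)]
  simp

lemma dissipator_sub (L X Y : Matrix (Fin d) (Fin d) ℂ) :
    dissipator L (X - Y) = dissipator L X - dissipator L Y := by
  simp only [dissipator, Matrix.mul_sub, Matrix.sub_mul, smul_add, smul_sub]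
  abel

lemma lindbladian_conjTranspose {H : Matrix (Fin d) (Fin d) ℂ} (hH : H.IsHermitian)
    (L : κ → Matrix (Fin d) (Fin d) ℂ) (X : Matrix (Fin d) (Fin d) ℂ) :
    (lindbladian H L X)ᴴ = lindbladian H L Xᴴ := by
  simp only [lindbladian, Matrix.conjTranspose_add, Matrix.conjTranspose_sum,
    dissipator_conjTranspose, Matrix.conjTranspose_smul, Matrix.conjTranspose_sub,
    Matrix.conjTranspose_mul, hH.eq]
  congr 1
  simp only [star_neg, RCLike.star_def, Complex.conj_I, neg_neg, neg_smul]
  rw [← smul_neg, neg_sub]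

lemma lindbladian_sub (H : Matrix (Fin d) (Fin d) ℂ)
    (L : κ → Matrix (Fin d) (Fin d) ℂ) (X Y : Matrix (Fin d) (Fin d) ℂ) :
    lindbladian H L (X - Y) = lindbladian H L X - lindbladian H L Y := by
  simp only [lindbladian, dissipator_sub, Finset.sum_sub_distrib, Matrix.mul_sub, Matrix.sub_mul,
    smul_sub]
  abel

lemma dissipator_smul (L X : Matrix (Fin d) (Fin d) ℂ) (c : ℂ) :
    dissipator L (c • X) = c • dissipator L X := by
  simp only [dissipator, Matrix.mul_smul, Matrix.smul_mul, smul_add, smul_sub, smul_comm c]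

lemma lindbladian_smul (H : Matrix (Fin d) (Fin d) ℂ)
    (L : κ → Matrix (Fin d) (Fin d) ℂ) (X : Matrix (Fin d) (Fin d) ℂ) (c : ℂ) :
    lindbladian H L (c • X) = c • lindbladian H L X := by
  simp only [lindbladian, dissipator_smul, Matrix.mul_smul, Matrix.smul_mul, smul_add, smul_sub,
    Finset.smul_sum, smul_comm c]

lemma trace_dissipator (L X : Matrix (Fin d) (Fin d) ℂ) : (dissipator L X).trace = 0 := by
  rw [dissipator, Matrix.trace_sub, Matrix.trace_smul, Matrix.trace_add,
    Matrix.trace_mul_comm X, Matrix.trace_mul_comm (L * X), Matrix.mul_assoc, smul_eq_mul]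
  ring

lemma trace_lindbladian (H : Matrix (Fin d) (Fin d) ℂ)
    (L : κ → Matrix (Fin d) (Fin d) ℂ) (X : Matrix (Fin d) (Fin d) ℂ) :
    (lindbladian H L X).trace = 0 := by
  rw [lindbladian, Matrix.trace_add, Matrix.trace_sum, Matrix.trace_smul, Matrix.trace_sub,
    Matrix.trace_mul_comm H]
  simp [trace_dissipator]

lemma IsLindbladSolution.isBoundedMeasurable (hρ : IsLindbladSolution τ H L ρ)
    (hH : IsBoundedMeasurable τ H) (hL : ∀ k, IsBoundedMeasurable τ (L k)) :
    IsBoundedMeasurable τ (fun t => QuantumLandauer.lindbladian (H t) (fun k => L k t) (ρ t)) :=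
  hH.lindbladian hL (isBoundedMeasurable_of_continuousOn hρ.1)

lemma IsLindbladSolution.exists_norm_sub_le (hρ : IsLindbladSolution τ H L ρ)
    (hH : IsBoundedMeasurable τ H) (hL : ∀ k, IsBoundedMeasurable τ (L k)) :
    ∃ K, ∀ s ∈ Icc 0 τ, ∀ t ∈ Icc 0 τ, ∀ i j, ‖ρ s i j - ρ t i j‖ ≤ K * |s - t| := by
  have hΛ := hρ.isBoundedMeasurable hH hL
  obtain ⟨K, hK⟩ := hΛ.2
  refine ⟨K, fun s hs t ht i j => ?_⟩
  have hint : ∀ r ∈ Icc 0 τ, IntervalIntegrable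
      (fun s => QuantumLandauer.lindbladian (H s) (fun k => L k s) (ρ s) i j) volume 0 r :=
    fun r hr => (hΛ.mono hr.2).intervalIntegrable hr.1 i j
  rw [hρ.2 s hs i j, hρ.2 t ht i j, add_sub_add_left_eq_sub,
    intervalIntegral.integral_interval_sub_left (hint s hs) (hint t ht)]
  refine intervalIntegral.norm_integral_le_of_norm_le_const fun x hx => ?_
  have hx' : x ∈ uIcc t s := uIoc_subset_uIcc hx
  exact hK x (uIcc_subset_Icc ht hs hx') i j

lemma IsLindbladSolution.ae_hasDerivAt (hρ : IsLindbladSolution τ H L ρ)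
    (hH : IsBoundedMeasurable τ H) (hL : ∀ k, IsBoundedMeasurable τ (L k)) (hτ : 0 ≤ τ) :
    ∀ᵐ t, t ∈ Icc 0 τ → ∀ i j, HasDerivAt (fun s => ρ s i j)
      (QuantumLandauer.lindbladian (H t) (fun k => L k t) (ρ t) i j) t := by
  have hΛ := hρ.isBoundedMeasurable hH hL
  have h : ∀ᵐ t, ∀ i j, t ∈ uIcc 0 τ → ∀ c ∈ uIcc 0 τ, HasDerivAt (fun x => ∫ s in c..x,
      QuantumLandauer.lindbladian (H s) (fun k => L k s) (ρ s) i j)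
      (QuantumLandauer.lindbladian (H t) (fun k => L k t) (ρ t) i j) t :=
    ae_all_iff.mpr fun i => ae_all_iff.mpr fun j =>
      (hΛ.intervalIntegrable hτ i j).ae_hasDerivAt_integral
  filter_upwards [h, Measure.ae_ne volume 0, Measure.ae_ne volume τ] with t h ht0 htτ ht i j
  have h' := (h i j (by rwa [uIcc_of_le hτ]) 0 left_mem_uIcc).const_add (ρ 0 i j)
  refine h'.congr_of_eventuallyEq ?_
  filter_upwards [Icc_mem_nhds (lt_of_le_of_ne ht.1 ht0.symm) (lt_of_le_of_ne ht.2 htτ)] with s hs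
  exact hρ.2 s hs i j

lemma IsLindbladSolution.trace_eq (hρ : IsLindbladSolution τ H L ρ)
    (hH : IsBoundedMeasurable τ H) (hL : ∀ k, IsBoundedMeasurable τ (L k)) {t : ℝ}
    (ht : t ∈ Icc 0 τ) : (ρ t).trace = (ρ 0).trace := by
  have hΛ := (hρ.isBoundedMeasurable hH hL).mono ht.2
  simp only [Matrix.trace, Matrix.diag_apply]
  rw [Finset.sum_congr rfl fun i _ => hρ.2 t ht i i, Finset.sum_add_distrib,
    ← intervalIntegral.integral_finsetSum fun i _ => hΛ.intervalIntegrable ht.1 i i]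
  have h0 : ∀ s, ∑ i, QuantumLandauer.lindbladian (H s) (fun k => L k s) (ρ s) i i = 0 :=
    fun s => trace_lindbladian (H s) (fun k => L k s) (ρ s)
  simp [h0]

/-- The generator commutes with conjugate transposition, so `ρ - ρᴴ` solves the same linear equation
with zero initial value, and Grönwall forces it to vanish. -/
lemma IsLindbladSolution.isHermitian (hρ : IsLindbladSolution τ H L ρ)
    (hH : IsBoundedMeasurable τ H) (hL : ∀ k, IsBoundedMeasurable τ (L k))
    (hherm : ∀ t ∈ Icc 0 τ, (H t).IsHermitian) (hρ0 : (ρ 0).IsHermitian) {t : ℝ}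
    (ht : t ∈ Icc 0 τ) : (ρ t).IsHermitian := by
  have hΛ := hρ.isBoundedMeasurable hH hL
  set E : ℝ → Matrix (Fin d) (Fin d) ℂ := fun t => ρ t - (ρ t)ᴴ with hE
  have hEc : ContinuousOn E (Icc 0 τ) :=
    hρ.1.sub (continuous_id.matrix_conjTranspose.comp_continuousOn hρ.1)
  have hEb := isBoundedMeasurable_of_continuousOn hEc
  have hEint : ∀ t ∈ Icc 0 τ, ∀ i j, E t i j =
      ∫ s in (0 : ℝ)..t, QuantumLandauer.lindbladian (H s) (fun k => L k s) (E s) i j := by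
    intro t ht i j
    have hΛt := hΛ.mono ht.2
    have h1 : (ρ t)ᴴ i j = ρ 0 i j + ∫ s in (0 : ℝ)..t,
        (QuantumLandauer.lindbladian (H s) (fun k => L k s) (ρ s))ᴴ i j := by
      rw [Matrix.conjTranspose_apply, hρ.2 t ht j i, star_add, ← Matrix.conjTranspose_apply (ρ 0),
        hρ0.eq]
      exact congrArg _ intervalIntegral.intervalIntegral_conj.symm
    change ρ t i j - (ρ t)ᴴ i j = _
    rw [h1, hρ.2 t ht i j, add_sub_add_left_eq_sub, ← intervalIntegral.integral_sub
      (hΛt.intervalIntegrable ht.1 i j) (hΛt.conjTranspose.intervalIntegrable ht.1 i j)]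
    refine intervalIntegral.integral_congr fun s hs => ?_
    rw [uIcc_of_le ht.1] at hs
    change _ = QuantumLandauer.lindbladian (H s) (fun k => L k s) (ρ s - (ρ s)ᴴ) i j
    rw [lindbladian_conjTranspose (hherm s ⟨hs.1, hs.2.trans ht.2⟩), lindbladian_sub,
      Matrix.sub_apply]
  obtain ⟨C, hC⟩ := hH.exists_entryNorm_le
  choose D hD using fun k => (hL k).exists_entryNorm_le
  set K : ℝ := 2 * |C| + ∑ k, 2 * |D k| ^ 2 with hK
  have hK0 : 0 ≤ K := by positivity
  have hbound : ∀ t ∈ Icc 0 τ, entryNorm (QuantumLandauer.lindbladian (H t) (fun k => L k t) (E t))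
      ≤ K * entryNorm (E t) := by
    intro t ht
    refine (entryNorm_lindbladian_le _ _ _).trans
      (mul_le_mul_of_nonneg_right ?_ (entryNorm_nonneg _))
    have := entryNorm_nonneg (H t)
    refine add_le_add (by linarith [hC t ht, le_abs_self C]) (Finset.sum_le_sum fun k _ => ?_)
    have := entryNorm_nonneg (L k t)
    gcongr
    exact (hD k t ht).trans (le_abs_self _)
  have hgron := nonpos_of_le_mul_integral (u := fun t => entryNorm (E t)) hK0
    (continuousOn_finsetSum _ fun i _ => continuousOn_finsetSum _ fun j _ =>
      ((continuous_id.matrix_elem i j).comp_continuousOn hEc).norm) ?_ t ht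
  · have hz : E t = 0 := by
      ext i j
      exact norm_le_zero_iff.mp ((norm_apply_le_entryNorm (E t) i j).trans hgron)
    exact (sub_eq_zero.mp hz).symm
  · intro t ht
    have hΛE := (hH.lindbladian hL hEb).mono ht.2
    calc entryNorm (E t) ≤ ∑ i, ∑ j, ∫ s in (0 : ℝ)..t,
          ‖QuantumLandauer.lindbladian (H s) (fun k => L k s) (E s) i j‖ :=
          Finset.sum_le_sum fun i _ => Finset.sum_le_sum fun j _ => by
            rw [hEint t ht i j]
            exact intervalIntegral.norm_integral_le_integral_norm ht.1
      _ = ∫ s in (0 : ℝ)..t, entryNorm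
          (QuantumLandauer.lindbladian (H s) (fun k => L k s) (E s)) := by
          unfold entryNorm
          rw [intervalIntegral.integral_finsetSum fun i _ => intervalIntegrable_fun_sum
            fun j _ => (hΛE.intervalIntegrable ht.1 i j).norm]
          refine Finset.sum_congr rfl fun i _ => ?_
          rw [intervalIntegral.integral_finsetSum
            fun j _ => (hΛE.intervalIntegrable ht.1 i j).norm]
      _ ≤ ∫ s in (0 : ℝ)..t, K * entryNorm (E s) :=
          intervalIntegral.integral_mono_on ht.1 (hΛE.intervalIntegrable_entryNorm ht.1)
            (((hEb.mono ht.2).intervalIntegrable_entryNorm ht.1).const_mul K)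
            fun s hs => hbound s ⟨hs.1, hs.2.trans ht.2⟩
      _ = K * ∫ s in (0 : ℝ)..t, entryNorm (E s) := intervalIntegral.integral_const_mul _ _

end Solution

/-! ### The generator as a classical jump process -/

section SpectralForm

variable {d : ℕ} {A : Matrix (Fin d) (Fin d) ℂ}

/-- Gain and loss of a master equation: a jump from `j` to `i` occurs at rate `transitionWeight`
times the population and changes `ψ` by the difference of its values. The two halves of the
anticommutator agree because `ψ(A)` commutes with `A`. -/
lemma trace_dissipator_mul_cfc (hA : A.IsHermitian) (L : Matrix (Fin d) (Fin d) ℂ) (ψ : ℝ → ℝ) :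
    (dissipator L A * cfc ψ A).trace.re = ∑ i, ∑ j, transitionWeight hA hA L i j *
      (hA.eigenvalues j * (ψ (hA.eigenvalues i) - ψ (hA.eigenvalues j))) := by
  have hself := cfc_self_eq hA
  have h1 : (L * A * Lᴴ * cfc ψ A).trace.re = ∑ i, ∑ j, transitionWeight hA hA L i j *
      (hA.eigenvalues j * ψ (hA.eigenvalues i)) := by
    have h := trace_conj_cfc hA hA L (fun x => x) ψ
    rw [hself] at h
    rw [h, Complex.ofReal_re]
  have h0 : (L * cfc (fun x => x * ψ x) A * Lᴴ).trace.re =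
      ∑ i, ∑ j, transitionWeight hA hA L i j * (hA.eigenvalues j * ψ (hA.eigenvalues j)) := by
    have h := trace_conj_cfc hA hA L (fun x => x * ψ x) (fun _ => 1)
    rw [cfc_one_eq_one hA, Matrix.mul_one] at h
    simp [h]
  have h2 : (Lᴴ * L * A * cfc ψ A).trace = (L * cfc (fun x => x * ψ x) A * Lᴴ).trace := by
    rw [← cfc_mul_cfc hA, hself, Matrix.trace_mul_comm _ Lᴴ]
    simp only [Matrix.mul_assoc]
  have h3 : (A * (Lᴴ * L) * cfc ψ A).trace = (L * cfc (fun x => x * ψ x) A * Lᴴ).trace := by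
    have hcomm : cfc (fun x => x * ψ x) A = cfc ψ A * A := by
      rw [← cfc_mul_cfc hA, (cfc_commute_cfc (fun x : ℝ => x) ψ A).eq, hself]
    rw [hcomm, Matrix.trace_mul_comm, Matrix.trace_mul_comm _ Lᴴ, ← Matrix.mul_assoc,
      Matrix.trace_mul_comm, Matrix.mul_assoc]
  rw [dissipator, Matrix.sub_mul, Matrix.smul_mul, Matrix.add_mul, Matrix.trace_sub,
    Matrix.trace_smul, Matrix.trace_add, h2, h3, ← two_mul, smul_eq_mul, ← mul_assoc,
    one_div_mul_cancel two_ne_zero, one_mul, Complex.sub_re, h1, h0, ← Finset.sum_sub_distrib]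
  refine Finset.sum_congr rfl fun i _ => ?_
  rw [← Finset.sum_sub_distrib]
  exact Finset.sum_congr rfl fun j _ => by ring

lemma trace_lindbladian_mul_cfc {κ : Type*} [Fintype κ] (hA : A.IsHermitian)
    (H : Matrix (Fin d) (Fin d) ℂ) (L : κ → Matrix (Fin d) (Fin d) ℂ) (ψ : ℝ → ℝ) :
    (lindbladian H L A * cfc ψ A).trace.re = ∑ k, ∑ i, ∑ j, transitionWeight hA hA (L k) i j *
      (hA.eigenvalues j * (ψ (hA.eigenvalues i) - ψ (hA.eigenvalues j))) := by
  have hself := cfc_self_eq hA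
  have hcomm : A * cfc ψ A = cfc ψ A * A := by
    have h := (cfc_commute_cfc (fun x : ℝ => x) ψ A).eq
    rwa [hself] at h
  have h0 : ((H * A - A * H) * cfc ψ A).trace = 0 := by
    rw [Matrix.sub_mul, Matrix.trace_sub, Matrix.mul_assoc, hcomm, ← Matrix.mul_assoc,
      Matrix.trace_mul_comm (H * cfc ψ A), Matrix.mul_assoc, sub_self]
  rw [lindbladian, Matrix.add_mul, Matrix.smul_mul, Matrix.trace_add, Matrix.trace_smul, h0,
    smul_zero, zero_add, Matrix.sum_mul, Matrix.trace_sum, Complex.re_sum]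
  exact Finset.sum_congr rfl fun k _ => trace_dissipator_mul_cfc hA (L k) ψ

/-- A crude bound independent of the eigenbasis, hence uniform in time although the eigenbasis is
chosen separately at each time. -/
lemma transitionWeight_le (hA : A.IsHermitian) (X : Matrix (Fin d) (Fin d) ℂ) (i j : Fin d) :
    transitionWeight hA hA X i j ≤ (((d : ℝ) * d) * entryNorm X * (d * d)) ^ 2 := by
  have hU : entryNorm (hA.eigenvectorUnitary : Matrix (Fin d) (Fin d) ℂ) ≤ (d : ℝ) * d := by
    refine (Finset.sum_le_sum fun i _ => Finset.sum_le_sum fun j _ =>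
      entry_norm_bound_of_unitary hA.eigenvectorUnitary.2 i j).trans_eq ?_
    simp
  have hX := entryNorm_nonneg X
  have hU0 := entryNorm_nonneg (hA.eigenvectorUnitary : Matrix (Fin d) (Fin d) ℂ)
  refine pow_le_pow_left₀ (norm_nonneg _) ((norm_apply_le_entryNorm _ i j).trans
    ((entryNorm_mul_le _ _).trans ?_)) 2
  refine (mul_le_mul_of_nonneg_right (entryNorm_mul_le _ _) hU0).trans ?_
  rw [entryNorm_conjTranspose]
  gcongr

/-- `C` dominates the total escape rate of every eigenvector, so adding `C • A` compensates the
outflow from populations below the threshold `c`. Negative eigenvalues leave an error, which the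
negative part of `A`, hence `max (c - x) 0`, absorbs. -/
lemma trace_lindbladian_add_smul_mul_cfc_le {κ : Type*} [Fintype κ] (hA : A.IsHermitian)
    (H : Matrix (Fin d) (Fin d) ℂ) (L : κ → Matrix (Fin d) (Fin d) ℂ) {c C : ℝ} (hc : 0 ≤ c)
    (hC : ∀ j, ∑ k, ∑ i, transitionWeight hA hA (L k) i j ≤ C) (hC0 : 0 ≤ C) :
    ((lindbladian H L A + (C : ℂ) • A) * cfc (fun x => if x < c then (-1 : ℝ) else 0) A).trace.re ≤
      C * (cfc (fun x => max (c - x) 0) A).trace.re := by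
  set ψ : ℝ → ℝ := fun x => if x < c then (-1 : ℝ) else 0 with hψ
  set p := hA.eigenvalues
  rw [Matrix.add_mul, Matrix.trace_add, Complex.add_re, trace_lindbladian_mul_cfc hA,
    Matrix.smul_mul, Matrix.trace_smul, trace_mul_cfc hA, trace_cfc hA, smul_eq_mul,
    ← Complex.ofReal_mul, Complex.ofReal_re, Complex.ofReal_re]
  have h1 : ∀ x y, y * (ψ x - ψ y) ≤ max y 0 * -ψ y := by
    intro x y
    simp only [hψ]
    rcases max_cases y 0 with ⟨h, h'⟩ | ⟨h, h'⟩ <;> rw [h] <;> split_ifs <;> linarith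
  have h2 : ∀ y, 0 ≤ max y 0 * -ψ y := by
    intro y
    refine mul_nonneg (le_max_right _ _) ?_
    simp only [hψ]
    split_ifs <;> norm_num
  have h3 : ∀ y, max y 0 * -ψ y + y * ψ y ≤ max (c - y) 0 := by
    intro y
    simp only [hψ]
    rcases max_cases y 0 with ⟨h, h'⟩ | ⟨h, h'⟩ <;>
      rcases max_cases (c - y) 0 with ⟨g, g'⟩ | ⟨g, g'⟩ <;> rw [h, g] <;> split_ifs <;> linarith
  have h4 : ∑ k, ∑ i, ∑ j, transitionWeight hA hA (L k) i j * (p j * (ψ (p i) - ψ (p j))) ≤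
      ∑ j, C * (max (p j) 0 * -ψ (p j)) := by
    calc _ ≤ ∑ k, ∑ i, ∑ j, transitionWeight hA hA (L k) i j * (max (p j) 0 * -ψ (p j)) :=
          Finset.sum_le_sum fun k _ => Finset.sum_le_sum fun i _ => Finset.sum_le_sum fun j _ =>
            mul_le_mul_of_nonneg_left (h1 _ _) (transitionWeight_nonneg hA hA (L k) i j)
      _ = ∑ j, (∑ k, ∑ i, transitionWeight hA hA (L k) i j) * (max (p j) 0 * -ψ (p j)) := by
          simp only [Finset.sum_mul]
          rw [Finset.sum_comm]
          conv_rhs => rw [Finset.sum_comm]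
          rw [Finset.sum_comm]
          exact Finset.sum_congr rfl fun k _ => Finset.sum_comm
      _ ≤ _ := Finset.sum_le_sum fun j _ => mul_le_mul_of_nonneg_right (hC j) (h2 _)
  refine (add_le_add_left h4 _).trans ?_
  rw [Finset.mul_sum, Finset.mul_sum, ← Finset.sum_add_distrib]
  refine Finset.sum_le_sum fun j _ => ?_
  rw [← mul_add]
  exact mul_le_mul_of_nonneg_left (h3 _) hC0

end SpectralForm

/-! ### Strict positivity of the state -/

section Positivity

variable {d : ℕ} {κ : Type*} [Fintype κ] {τ : ℝ} {H ρ : ℝ → Matrix (Fin d) (Fin d) ℂ}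
  {L : κ → ℝ → Matrix (Fin d) (Fin d) ℂ}

lemma abs_exp_mul_sub_exp_mul_le {C s t : ℝ} (hC : 0 ≤ C) (hs : s ∈ Icc 0 τ) (ht : t ∈ Icc 0 τ) :
    |Real.exp (C * s) - Real.exp (C * t)| ≤ C * Real.exp (C * τ) * |s - t| := by
  refine (convex_Icc 0 τ).norm_image_sub_le_of_norm_hasDerivWithin_le
    (f := fun x => Real.exp (C * x)) (f' := fun x => Real.exp (C * x) * C) (fun x _ => ?_)
    (fun x hx => ?_) ht hs
  · simpa using (((hasDerivAt_id x).const_mul C).exp).hasDerivWithinAt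
  · rw [Real.norm_eq_abs, abs_of_nonneg (by positivity), mul_comm]
    gcongr
    exact hx.2

/-- Populations decay at most at rate `C`. After rescaling by `exp (C t)`, the deficit `Tr (c -
A_t)₊` starts at zero and obeys a Grönwall inequality, so no eigenvalue of `A_t` falls below `c`. -/
lemma IsLindbladSolution.spectrum_subset_Ici (hρ : IsLindbladSolution τ H L ρ)
    (hH : IsBoundedMeasurable τ H) (hL : ∀ k, IsBoundedMeasurable τ (L k))
    (hherm : ∀ t ∈ Icc 0 τ, (H t).IsHermitian) (hρ0 : (ρ 0).IsHermitian) {c : ℝ} (hc : 0 < c)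
    (hρc : spectrum ℝ (ρ 0) ⊆ Ici c) :
    ∃ c' > 0, ∀ t ∈ Icc 0 τ, spectrum ℝ (ρ t) ⊆ Ici c' := by
  rcases lt_or_ge τ 0 with hτ | hτ
  · exact ⟨1, one_pos, fun t ht => absurd (ht.1.trans ht.2) (not_le.mpr hτ)⟩
  have hherm' := fun t ht => hρ.isHermitian hH hL hherm hρ0 (t := t) ht
  choose D hD using fun k => (hL k).exists_entryNorm_le
  set C : ℝ := ∑ k, ∑ _i : Fin d, (((d : ℝ) * d) * D k * (d * d)) ^ 2 with hCdef
  have hC0 : 0 ≤ C := Finset.sum_nonneg fun k _ => Finset.sum_nonneg fun i _ => sq_nonneg _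
  set A : ℝ → Matrix (Fin d) (Fin d) ℂ := fun t => ((Real.exp (C * t) : ℝ) : ℂ) • ρ t with hAdef
  have hA : ∀ t ∈ Icc 0 τ, (A t).IsHermitian := fun t ht => by
    rw [hAdef, Matrix.IsHermitian, Matrix.conjTranspose_smul, (hherm' t ht).eq]
    simp only [RCLike.star_def, Complex.conj_ofReal]
  have hC : ∀ t (ht : t ∈ Icc 0 τ) j,
      ∑ k, ∑ i, transitionWeight (hA t ht) (hA t ht) (L k t) i j ≤ C := fun t ht j =>
    Finset.sum_le_sum fun k _ => Finset.sum_le_sum fun i _ =>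
      (transitionWeight_le (hA t ht) (L k t) i j).trans (by
        have := entryNorm_nonneg (L k t)
        have := hD k t ht
        gcongr)
  have hφ : ∀ x ∈ (univ : Set ℝ), ∀ y ∈ (univ : Set ℝ),
      max (c - y) 0 + (x - y) * (if y < c then (-1 : ℝ) else 0) ≤ max (c - x) 0 := by
    intro x _ y _
    have h1 := le_max_left (c - x) 0
    have h2 := le_max_right (c - x) 0
    split_ifs with h
    · rw [max_eq_left (by linarith)]; linarith
    · rw [max_eq_right (by linarith)]; linarith
  have hψ : ∀ x ∈ (univ : Set ℝ), |if x < c then (-1 : ℝ) else 0| ≤ 1 := by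
    intro x _
    split_ifs <;> simp
  obtain ⟨K, hK⟩ := hρ.exists_norm_sub_le hH hL
  obtain ⟨B, hB⟩ := (isBoundedMeasurable_of_continuousOn hρ.1).2
  have hLip : ∀ s ∈ Icc 0 τ, ∀ t ∈ Icc 0 τ, ∀ i j, ‖A s i j - A t i j‖ ≤
      (Real.exp (C * τ) * K + C * Real.exp (C * τ) * B) * |s - t| := by
    intro s hs t ht i j
    have h1 : A s i j - A t i j = ((Real.exp (C * s) : ℝ) : ℂ) * (ρ s i j - ρ t i j) +
        ((Real.exp (C * s) - Real.exp (C * t) : ℝ) : ℂ) * ρ t i j := by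
      simp only [hAdef, Matrix.smul_apply, smul_eq_mul]
      push_cast
      ring
    rw [h1]
    refine (norm_add_le _ _).trans ?_
    rw [norm_mul, norm_mul, Complex.norm_real, Complex.norm_real, Real.norm_eq_abs,
      Real.norm_eq_abs, abs_of_pos (Real.exp_pos _)]
    have h2 := hK s hs t ht i j
    have h3 := abs_exp_mul_sub_exp_mul_le hC0 hs ht
    have h4 := hB t ht i j
    have h5 : Real.exp (C * s) ≤ Real.exp (C * τ) := by
      gcongr
      exact hs.2
    have h6 : 0 ≤ C * Real.exp (C * τ) * |s - t| := (abs_nonneg _).trans h3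
    calc _ ≤ Real.exp (C * τ) * (K * |s - t|) + C * Real.exp (C * τ) * |s - t| * B := by gcongr
      _ = _ := by ring
  have hderiv : ∀ᵐ t, t ∈ Icc 0 τ → ∀ i j, HasDerivAt (fun s => A s i j)
      ((QuantumLandauer.lindbladian (H t) (fun k => L k t) (A t) + (C : ℂ) • A t) i j) t := by
    filter_upwards [hρ.ae_hasDerivAt hH hL hτ] with t h ht i j
    have h1 : HasDerivAt (fun s : ℝ => ((Real.exp (C * s) : ℝ) : ℂ))
        ((Real.exp (C * t) * C : ℝ) : ℂ) t := by
      have : HasDerivAt (fun s : ℝ => Real.exp (C * s)) (Real.exp (C * t) * C) t := by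
        simpa using ((hasDerivAt_id t).const_mul C).exp
      exact this.ofReal_comp
    refine (h1.mul (h ht i j)).congr_deriv ?_
    simp only [hAdef, lindbladian_smul, Matrix.add_apply, Matrix.smul_apply, smul_eq_mul]
    push_cast
    ring
  set P : ℝ → ℝ := fun t => (cfc (fun x => max (c - x) 0) (A t)).trace.re with hP
  have hPc : ContinuousOn P (Icc 0 τ) :=
    (exists_lipschitzOnWith_trace_cfc hA (fun _ _ => subset_univ _) hφ hψ hLip).choose_spec
      |>.continuousOn
  have hP0 : P 0 = 0 := by
    have h0 : A 0 = ρ 0 := by simp [hAdef]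
    simp only [hP, h0]
    rw [trace_cfc hρ0, Complex.ofReal_re]
    refine Finset.sum_eq_zero fun i _ => max_eq_right ?_
    exact sub_nonpos.mpr (hρc (hρ0.eigenvalues_mem_spectrum_real i))
  have hPle : ∀ t ∈ Icc 0 τ, P t ≤ 0 := by
    refine nonpos_of_le_mul_integral hC0 hPc fun t ht => ?_
    have hsub : ∀ {s}, s ∈ Icc 0 t → s ∈ Icc 0 τ := fun hs => ⟨hs.1, hs.2.trans ht.2⟩
    have h := trace_cfc_sub_le_integral (h := fun s => C * P s) ht.1 (fun s hs => hA s (hsub hs))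
      (fun _ _ => subset_univ _) hφ hψ
      (fun s hs r hr => hLip s (hsub hs) r (hsub hr))
      (hderiv.mono fun s h hs => h (hsub hs))
      ((hPc.mono fun s hs => hsub (by rwa [uIcc_of_le ht.1] at hs)).intervalIntegrable.const_mul C)
      (fun s hs => trace_lindbladian_add_smul_mul_cfc_le (hA s (hsub hs)) _ _ hc.le
        (hC s (hsub hs)) hC0)
    rw [intervalIntegral.integral_const_mul] at h
    change P t - P 0 ≤ _ at h
    linarith
  -- Undoing the rescaling costs at most the factor `exp (-C τ)`.
  refine ⟨c * Real.exp (-(C * τ)), by positivity, fun t ht x hx => ?_⟩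
  have hAx : Real.exp (C * t) * x ∈ spectrum ℝ (A t) := by
    have := (spectrum.smul_mem_smul_iff (r := Units.mk0 (Real.exp (C * t)) (Real.exp_pos _).ne')
      (s := x) (a := ρ t)).mpr hx
    simp only [Units.smul_def, Units.val_mk0, smul_eq_mul] at this
    rwa [← Complex.coe_smul] at this
  rw [(hA t ht).spectrum_real_eq_range_eigenvalues] at hAx
  obtain ⟨i, hi⟩ := hAx
  have hsum := hPle t ht
  simp only [hP] at hsum
  rw [trace_cfc (hA t ht), Complex.ofReal_re] at hsum
  have h1 : max (c - (hA t ht).eigenvalues i) 0 ≤ 0 :=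
    (Finset.single_le_sum (f := fun i => max (c - (hA t ht).eigenvalues i) 0)
      (fun _ _ => le_max_right _ _) (Finset.mem_univ i)).trans hsum
  rw [hi] at h1
  have h2 : c ≤ Real.exp (C * t) * x := by linarith [(le_max_left _ _).trans h1]
  have h3 : Real.exp (-(C * τ)) ≤ Real.exp (-(C * t)) := by
    have := mul_le_mul_of_nonneg_left ht.2 hC0
    gcongr
  calc c * Real.exp (-(C * τ)) ≤ (Real.exp (C * t) * x) * Real.exp (-(C * t)) :=
        mul_le_mul h2 h3 (Real.exp_pos _).le (hc.le.trans h2)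
    _ = x := by rw [mul_right_comm, ← Real.exp_add]; simp

end Positivity

/-! ### Scalar inequalities for flows and entropy -/

section ScalarInequalities

/-- The logarithmic mean is at most the arithmetic mean; for `b ≤ a` this is `log (1 + x) ≥ 2 x / (x
+ 2)` at `x = (a - b) / b`. -/
lemma two_mul_sub_sq_div_add_le {a b : ℝ} (ha : 0 < a) (hb : 0 < b) :
    2 * (a - b) ^ 2 / (a + b) ≤ (a - b) * (Real.log a - Real.log b) := by
  wlog h : b ≤ a generalizing a b
  · have := this hb ha (le_of_not_ge h)
    rw [add_comm b a] at this
    calc _ = 2 * (b - a) ^ 2 / (a + b) := by ring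
      _ ≤ _ := this
      _ = _ := by ring
  have h1 := Real.le_log_one_add_of_nonneg (x := (a - b) / b) (div_nonneg (by linarith) hb.le)
  have h2 : 1 + (a - b) / b = a / b := by field_simp; ring
  have h3 : 2 * ((a - b) / b) / ((a - b) / b + 2) = 2 * (a - b) / (a + b) := by
    have : (a - b) / b + 2 = (a + b) / b := by field_simp; ring
    rw [this]
    field_simp
  rw [h2, h3, Real.log_div ha.ne' hb.ne'] at h1
  calc 2 * (a - b) ^ 2 / (a + b) = (a - b) * (2 * (a - b) / (a + b)) := by ring
    _ ≤ _ := mul_le_mul_of_nonneg_left h1 (by linarith)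

/-- The thermodynamic trade-off between a probability current `a - b`, the affinity
`log a - log b` and the traffic `a + b`. -/
lemma affinity_tradeoff {a b x l : ℝ} (ha : 0 < a) (hb : 0 < b) (hx : |x| ≤ 2 * l) :
    0 ≤ (a - b) * (Real.log a - Real.log b - x) + (a + b) * (l ^ 2 / 2) := by
  have h1 := two_mul_sub_sq_div_add_le ha hb
  have hs : 0 < a + b := by linarith
  have h2 : (a - b) * x ≤ |a - b| * (2 * l) :=
    (le_abs_self _).trans (by rw [abs_mul]; gcongr)
  have h3 : |a - b| * (2 * l) ≤ 2 * (a - b) ^ 2 / (a + b) + (a + b) * (l ^ 2 / 2) := by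
    -- Completing the square; equality holds when `2 |a - b| = (a + b) l`.
    have h4 : 2 * (a - b) ^ 2 / (a + b) + (a + b) * (l ^ 2 / 2) - |a - b| * (2 * l) =
        (2 * |a - b| - (a + b) * l) ^ 2 / (2 * (a + b)) := by
      rw [← sq_abs (a - b)]
      field_simp
      ring
    have : 0 ≤ (2 * |a - b| - (a + b) * l) ^ 2 / (2 * (a + b)) := by positivity
    linarith
  linarith

/-- The tangent line of `x log x` at `y`, obtained from `log u ≤ u - 1` at `u = y / x`. -/
lemma mul_log_add_sub_mul_le {x y : ℝ} (hx : 0 < x) (hy : 0 < y) :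
    y * Real.log y + (x - y) * (Real.log y + 1) ≤ x * Real.log x := by
  have h := Real.log_le_sub_one_of_pos (div_pos hy hx)
  rw [Real.log_div hy.ne' hx.ne'] at h
  have h' := mul_le_mul_of_nonneg_left h hx.le
  have : x * (y / x - 1) = y - x := by field_simp
  linarith

end ScalarInequalities

/-! ### Heat and entropy production under detailed balance -/

section DetailedBalance

variable {d : ℕ} {A : Matrix (Fin d) (Fin d) ℂ}

lemma transitionWeight_smul_conjTranspose (hA : A.IsHermitian) (X : Matrix (Fin d) (Fin d) ℂ)
    (r : ℝ) (i j : Fin d) :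
    transitionWeight hA hA ((r : ℂ) • Xᴴ) i j = r ^ 2 * transitionWeight hA hA X j i := by
  unfold transitionWeight
  set U := (hA.eigenvectorUnitary : Matrix (Fin d) (Fin d) ℂ)
  have : Uᴴ * ((r : ℂ) • Xᴴ) * U = (r : ℂ) • (Uᴴ * X * U)ᴴ := by
    simp [Matrix.conjTranspose_mul, Matrix.mul_assoc]
  rw [this, Matrix.smul_apply, norm_smul, Matrix.conjTranspose_apply, norm_star, mul_pow,
    Complex.norm_real, Real.norm_eq_abs, sq_abs]

lemma trace_activity (hA : A.IsHermitian) (L : Matrix (Fin d) (Fin d) ℂ) :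
    (L * A * Lᴴ).trace =
      ((∑ i, ∑ j, transitionWeight hA hA L i j * hA.eigenvalues j : ℝ) : ℂ) := by
  have h := trace_conj_cfc hA hA L (fun x => x) (fun _ => 1)
  rw [cfc_self_eq hA, cfc_one_eq_one hA, Matrix.mul_one] at h
  simpa using h

lemma trace_mul_conjTranspose_mul (L X : Matrix (Fin d) (Fin d) ℂ) :
    (X * Lᴴ * L).trace = (L * X * Lᴴ).trace := by
  rw [Matrix.trace_mul_comm, ← Matrix.mul_assoc]

/-- A jump operator that lowers the energy by `ω` removes energy at the rate `ω Tr (L X Lᴴ)`. -/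
lemma trace_mul_dissipator_of_commutator {H L : Matrix (Fin d) (Fin d) ℂ} (hH : H.IsHermitian)
    {ω : ℝ} (hL : L * H - H * L = (ω : ℂ) • L) (X : Matrix (Fin d) (Fin d) ℂ) :
    (H * dissipator L X).trace = -(ω : ℂ) * (L * X * Lᴴ).trace := by
  have hL1 : L * H = H * L + (ω : ℂ) • L := by rw [← hL]; abel
  have hL2 : H * Lᴴ = Lᴴ * H + (ω : ℂ) • Lᴴ := by
    have := congrArg Matrix.conjTranspose hL1
    simpa [Matrix.conjTranspose_mul, hH.eq] using this
  have hcomm : Lᴴ * L * H = H * (Lᴴ * L) := by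
    rw [← Matrix.mul_assoc, hL2, Matrix.mul_assoc, hL1, Matrix.mul_add, Matrix.add_mul,
      Matrix.mul_assoc, Matrix.mul_smul, Matrix.smul_mul]
  have h1 : (H * (L * X * Lᴴ)).trace =
      (H * (Lᴴ * L * X)).trace - (ω : ℂ) * (L * X * Lᴴ).trace := by
    have hHL : H * L = L * H - (ω : ℂ) • L := by rw [hL1]; abel
    have e1 : (H * (Lᴴ * L * X)).trace = (L * H * X * Lᴴ).trace := by
      rw [← Matrix.mul_assoc, ← hcomm, Matrix.mul_assoc Lᴴ, Matrix.mul_assoc Lᴴ,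
        Matrix.trace_mul_comm]
    rw [e1, ← Matrix.mul_assoc, ← Matrix.mul_assoc, hHL]
    simp only [Matrix.sub_mul, Matrix.smul_mul, Matrix.trace_sub, Matrix.trace_smul, smul_eq_mul]
  have h2 : (H * (X * (Lᴴ * L))).trace = (H * (Lᴴ * L * X)).trace := by
    rw [← Matrix.mul_assoc, Matrix.trace_mul_comm, ← Matrix.mul_assoc, hcomm, Matrix.mul_assoc]
  rw [dissipator, Matrix.mul_sub, Matrix.trace_sub, Matrix.mul_smul, Matrix.trace_smul,
    Matrix.mul_add, Matrix.trace_add, h1, h2, smul_eq_mul]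
  ring

variable {κ : Type*} [Fintype κ]

lemma trace_mul_lindbladian_of_commutator {H : Matrix (Fin d) (Fin d) ℂ}
    {L : κ → Matrix (Fin d) (Fin d) ℂ} {ω : κ → ℝ} (hH : H.IsHermitian) (hA : A.IsHermitian)
    (hL : ∀ k, L k * H - H * L k = (ω k : ℂ) • L k) :
    (H * lindbladian H L A).trace.re =
      -∑ k, ∑ i, ∑ j, transitionWeight hA hA (L k) i j * (hA.eigenvalues j * ω k) := by
  have h0 : (H * (H * A - A * H)).trace = 0 := by
    rw [Matrix.mul_sub, Matrix.trace_sub, ← Matrix.mul_assoc H A, Matrix.trace_mul_comm (H * A),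
      sub_self]
  rw [lindbladian, Matrix.mul_add, Matrix.trace_add, Matrix.mul_smul, Matrix.trace_smul, h0,
    smul_zero, zero_add, Matrix.mul_sum, Matrix.trace_sum, Complex.re_sum, ← Finset.sum_neg_distrib]
  refine Finset.sum_congr rfl fun k _ => ?_
  rw [trace_mul_dissipator_of_commutator hH (hL k), trace_activity hA, ← Complex.ofReal_neg,
    ← Complex.ofReal_mul, Complex.ofReal_re, neg_mul, Finset.mul_sum]
  congr 1
  refine Finset.sum_congr rfl fun i _ => ?_
  rw [Finset.mul_sum]
  exact Finset.sum_congr rfl fun j _ => by ring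

/-- Under detailed balance, the change of free energy and of a bounded spectral observable is
controlled by the dynamical activity. -/
lemma trace_lindbladian_mul_cfc_le {β l : ℝ} {H : Matrix (Fin d) (Fin d) ℂ}
    {L : κ → Matrix (Fin d) (Fin d) ℂ} {ω : κ → ℝ} {rev : κ → κ} (hrev : Function.Involutive rev)
    (hH : H.IsHermitian) (hA : A.IsHermitian) (hpos : ∀ i, 0 < hA.eigenvalues i)
    (hL : ∀ k, L k * H - H * L k = (ω k : ℂ) • L k)
    (hDB : ∀ k, L k = (Real.exp (β * ω k / 2) : ℂ) • (L (rev k))ᴴ)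
    (hl : 0 ≤ l) {W : ℝ → ℝ} (hW : ∀ x, |W x| ≤ 1) :
    (lindbladian H L A * cfc (fun x => Real.log x + 1 + l * W x) A).trace.re ≤
      -β * (H * lindbladian H L A).trace.re + l ^ 2 / 2 * ∑ k, (A * (L k)ᴴ * L k).trace.re := by
  set p := hA.eigenvalues
  set ψ : ℝ → ℝ := fun x => Real.log x + 1 + l * W x with hψ
  set w : κ → Fin d → Fin d → ℝ := fun k i j => transitionWeight hA hA (L k) i j with hw
  have hw0 : ∀ k i j, 0 ≤ w k i j := fun k i j => transitionWeight_nonneg hA hA (L k) i j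
  have hwrev : ∀ k i j, w k i j = Real.exp (β * ω k) * w (rev k) j i := by
    intro k i j
    simp only [hw]
    conv_lhs => rw [hDB k]
    rw [transitionWeight_smul_conjTranspose, ← Real.exp_nat_mul]
    congr 2
    push_cast
    ring
  -- `F` is the summand of right side minus left side. It need not be nonnegative alone, only when
  -- added to that of the reversed jump.
  set F : κ → Fin d → Fin d → ℝ := fun k i j =>
    w k i j * (p j * (β * ω k + l ^ 2 / 2 - (ψ (p i) - ψ (p j)))) with hF
  have hpair : ∀ k i j, 0 ≤ F k i j + F (rev k) j i := by
    intro k i j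
    rcases (hw0 (rev k) j i).eq_or_lt with h0 | h0
    -- Both weights vanish together. This case is separated because the logarithms below need
    -- positive flows and because `ω` is unconstrained on a zero jump operator.
    · simp [hF, hwrev k i j, ← h0]
    have hk : 0 < w k i j := by rw [hwrev k i j]; positivity
    -- Applying the pairing twice returns the same nonzero weight, so the two exponential factors
    -- multiply to `1`.
    have hω : β * ω (rev k) = -(β * ω k) := by
      have h1 := hwrev (rev k) j i
      rw [hrev k, hwrev k i j, ← mul_assoc, ← Real.exp_add] at h1
      have h2 : Real.exp (β * ω (rev k) + β * ω k) = 1 := by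
        have := mul_right_cancel₀ h0.ne' ((one_mul _).trans h1)
        exact this.symm
      have h3 := (Real.exp_eq_one_iff _).mp h2
      linarith
    have hlog : Real.log (w k i j * p j) - Real.log (w (rev k) j i * p i) =
        β * ω k + Real.log (p j) - Real.log (p i) := by
      rw [Real.log_mul hk.ne' (hpos j).ne', Real.log_mul h0.ne' (hpos i).ne', hwrev k i j,
        Real.log_mul (Real.exp_pos _).ne' h0.ne', Real.log_exp]
      ring
    have hx : |l * (W (p i) - W (p j))| ≤ 2 * l := by
      rw [abs_mul, abs_of_nonneg hl]
      have h1 := abs_sub (W (p i)) (W (p j))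
      nlinarith [hW (p i), hW (p j)]
    have := affinity_tradeoff (mul_pos hk (hpos j)) (mul_pos h0 (hpos i)) hx
    rw [hlog] at this
    simp only [hF, hψ, hω]
    linarith
  -- Reversal permutes the index triples, so the sum over pairs is twice the sum of `F`.
  have hsymm : ∑ k, ∑ i, ∑ j, F (rev k) j i = ∑ k, ∑ i, ∑ j, F k i j := by
    rw [← Equiv.sum_comp hrev.toPerm (fun k => ∑ i, ∑ j, F k i j)]
    exact Finset.sum_congr rfl fun k _ => Finset.sum_comm
  have hnonneg : 0 ≤ ∑ k, ∑ i, ∑ j, F k i j := by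
    have : 0 ≤ ∑ k, ∑ i, ∑ j, (F k i j + F (rev k) j i) :=
      Finset.sum_nonneg fun k _ => Finset.sum_nonneg fun i _ => Finset.sum_nonneg fun j _ =>
        hpair k i j
    simp only [Finset.sum_add_distrib, hsymm] at this
    linarith
  have hact : ∑ k, (A * (L k)ᴴ * L k).trace.re = ∑ k, ∑ i, ∑ j, w k i j * p j :=
    Finset.sum_congr rfl fun k _ => by
      rw [trace_mul_conjTranspose_mul, trace_activity hA, Complex.ofReal_re]
  rw [trace_lindbladian_mul_cfc hA, trace_mul_lindbladian_of_commutator hH hA hL, hact,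
    neg_mul_neg, ← sub_nonneg]
  refine hnonneg.trans_eq ?_
  simp only [Finset.mul_sum, ← Finset.sum_add_distrib, ← Finset.sum_sub_distrib]
  refine Finset.sum_congr rfl fun k _ => Finset.sum_congr rfl fun i _ =>
    Finset.sum_congr rfl fun j _ => ?_
  simp only [hF, hw]
  ring

end DetailedBalance

/-! ### The Landauer bound with a free parameter -/

section Landauer

variable {d : ℕ} {κ : Type*} [Fintype κ] {β τ : ℝ} {H ρ : ℝ → Matrix (Fin d) (Fin d) ℂ}
  {L : κ → ℝ → Matrix (Fin d) (Fin d) ℂ}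

lemma traceNorm_zero : traceNorm (0 : Matrix (Fin d) (Fin d) ℂ) = 0 := by
  rw [traceNorm_eq_sum_abs_eigenvalues Matrix.isHermitian_zero,
    (Matrix.IsHermitian.eigenvalues_eq_zero_iff _).mpr rfl]
  simp

lemma maximallyMixed_eq : maximallyMixed d = (((d : ℝ)⁻¹ : ℝ) : ℂ) • 1 := by
  simp [maximallyMixed]

lemma maximallyMixed_isHermitian : (maximallyMixed d).IsHermitian := by
  rw [maximallyMixed_eq, Matrix.IsHermitian, Matrix.conjTranspose_smul]
  simp

lemma eigenvalues_maximallyMixed (h : (maximallyMixed d).IsHermitian) (i : Fin d) :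
    h.eigenvalues i = (d : ℝ)⁻¹ := by
  have h1 := traceNorm_smul_one_sub h (d : ℝ)⁻¹
  rw [← maximallyMixed_eq, sub_self, traceNorm_zero, eq_comm,
    Finset.sum_eq_zero_iff_of_nonneg fun _ _ => abs_nonneg _] at h1
  have := abs_eq_zero.mp (h1 i (Finset.mem_univ i))
  linarith

/-- The value `(d + 1)⁻¹` is used instead of `d⁻¹` because it is positive also for `d = 0`. -/
lemma spectrum_maximallyMixed_subset : spectrum ℝ (maximallyMixed d) ⊆ Ici ((d : ℝ) + 1)⁻¹ := by
  rw [maximallyMixed_isHermitian.spectrum_real_eq_range_eigenvalues]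
  rintro _ ⟨i, rfl⟩
  rw [eigenvalues_maximallyMixed, mem_Ici]
  have : (0 : ℝ) < d := by exact_mod_cast i.pos
  gcongr
  linarith

/-- The spectrum of a Hermitian matrix with nonnegative eigenvalues is bounded by its trace. -/
lemma spectrum_subset_Iic_trace {A : Matrix (Fin d) (Fin d) ℂ} (hA : A.IsHermitian)
    (h0 : spectrum ℝ A ⊆ Ici 0) : spectrum ℝ A ⊆ Iic A.trace.re := by
  have htr : A.trace.re = ∑ i, hA.eigenvalues i := by
    rw [hA.trace_eq_sum_eigenvalues]
    simp
  intro x hx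
  rw [hA.spectrum_real_eq_range_eigenvalues] at hx
  obtain ⟨i, rfl⟩ := hx
  rw [mem_Iic, htr]
  exact Finset.single_le_sum (fun j _ => h0 (hA.eigenvalues_mem_spectrum_real j))
    (Finset.mem_univ i)

lemma dissipatedHeat_eq (hρ : IsLindbladSolution τ H L ρ) (hH : IsBoundedMeasurable τ H)
    (hL : ∀ k, IsBoundedMeasurable τ (L k)) (hτ : 0 ≤ τ) :
    dissipatedHeat τ H ρ =
      -∫ t in (0 : ℝ)..τ, (H t * lindbladian (H t) (fun k => L k t) (ρ t)).trace.re := by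
  rw [dissipatedHeat]
  congr 1
  refine intervalIntegral.integral_congr_ae ?_
  filter_upwards [hρ.ae_hasDerivAt hH hL hτ] with t h ht
  rw [← uIcc_of_le hτ] at h
  congr 3
  ext i j
  exact (h (uIoc_subset_uIcc ht) i j).deriv

lemma trace_mul_log_add_smul_abs {A : Matrix (Fin d) (Fin d) ℂ} (hA : A.IsHermitian) (l c : ℝ) :
    (cfc (fun x => x * Real.log x + l * |x - c|) A).trace.re =
      -vonNeumannEntropy A + l * traceNorm ((c : ℂ) • 1 - A) := by
  rw [vonNeumannEntropy, neg_neg, trace_mul_cfc hA, traceNorm_smul_one_sub hA, trace_cfc hA,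
    Complex.ofReal_re, Complex.ofReal_re, Finset.mul_sum, ← Finset.sum_add_distrib]
  simp only [abs_sub_comm c]

/-- The Legendre transform, in the parameter `l`, of the Landauer bound. -/
lemma entropyDecrease_add_mul_traceNorm_le (hτ : 0 < τ)
    (hH : ∀ t ∈ Icc 0 τ, (H t).IsHermitian) (hHreg : IsBoundedMeasurable τ H)
    (hLreg : ∀ k, IsBoundedMeasurable τ (L k)) (hDB : DetailedBalance β τ H L)
    (hρ : IsLindbladSolution τ H L ρ) (hρ0 : ρ 0 = maximallyMixed d) {l : ℝ} (hl : 0 ≤ l) :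
    entropyDecrease τ ρ + l * traceNorm (ρ 0 - ρ τ) ≤
      β * dissipatedHeat τ H ρ + l ^ 2 / 2 * (τ * meanActivity τ L ρ) := by
  obtain ⟨ω, rev, hrev, hω⟩ := hDB
  have hρ0h : (ρ 0).IsHermitian := hρ0 ▸ maximallyMixed_isHermitian
  have hherm := fun t ht => hρ.isHermitian hHreg hLreg hH hρ0h (t := t) ht
  obtain ⟨c, hc, hspec⟩ := hρ.spectrum_subset_Ici hHreg hLreg hH hρ0h
    (c := ((d : ℝ) + 1)⁻¹) (by positivity) (hρ0 ▸ spectrum_maximallyMixed_subset)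
  obtain ⟨K, hK⟩ := hρ.exists_norm_sub_le hHreg hLreg
  set B := (ρ 0).trace.re
  set m : ℝ := (d : ℝ)⁻¹
  -- A compact interval in the positive reals, on which the subgradient containing `log` is bounded:
  -- positivity gives the lower end, conservation of trace the upper.
  have hI : ∀ t ∈ Icc 0 τ, spectrum ℝ (ρ t) ⊆ Icc c B := fun t ht x hx =>
    ⟨hspec t ht hx, by
      have := spectrum_subset_Iic_trace (hherm t ht)
        ((hspec t ht).trans (Ici_subset_Ici.mpr hc.le)) hx
      rwa [hρ.trace_eq hHreg hLreg ht] at this⟩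
  have hsign : ∀ x : ℝ, |(SignType.sign (x - m) : ℝ)| ≤ 1 := by
    intro x
    rcases lt_trichotomy (x - m) 0 with h | h | h <;> simp [h]
  have hφ : ∀ x ∈ Icc c B, ∀ y ∈ Icc c B,
      (y * Real.log y + l * |y - m|) + (x - y) *
        (Real.log y + 1 + l * (SignType.sign (y - m) : ℝ)) ≤
      x * Real.log x + l * |x - m| := by
    intro x hx y hy
    have h1 := mul_log_add_sub_mul_le (hc.trans_le hx.1) (hc.trans_le hy.1)
    have h2 := mul_le_mul_of_nonneg_left (abs_add_mul_sign_le (x - m) (y - m)) hl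
    rw [sub_sub_sub_cancel_right] at h2
    linarith
  have hψ : ∀ x ∈ Icc c B, |Real.log x + 1 + l * (SignType.sign (x - m) : ℝ)| ≤
      |Real.log c| + |Real.log B| + 1 + l := by
    intro x hx
    have hx0 := hc.trans_le hx.1
    have h1 := Real.log_le_log hc hx.1
    have h2 := Real.log_le_log hx0 hx.2
    have h3 : |Real.log x| ≤ |Real.log c| + |Real.log B| := by
      rw [abs_le]
      constructor
      · linarith [neg_abs_le (Real.log c), abs_nonneg (Real.log B)]
      · linarith [le_abs_self (Real.log B), abs_nonneg (Real.log c)]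
    have h4 : |l * (SignType.sign (x - m) : ℝ)| ≤ l := by
      rw [abs_mul, abs_of_nonneg hl]
      exact mul_le_of_le_one_right hl (hsign x)
    refine (abs_add_le _ _).trans (add_le_add ((abs_add_le _ _).trans ?_) h4)
    rw [abs_one]
    linarith
  have hact : IntervalIntegrable (fun t => ∑ k, (ρ t * (L k t)ᴴ * L k t).trace.re) volume 0 τ :=
    intervalIntegrable_fun_sum fun k _ => (((isBoundedMeasurable_of_continuousOn hρ.1).mul
      (hLreg k).conjTranspose).mul (hLreg k)).intervalIntegrable_trace_re hτ.le
  have hheat := (hHreg.mul (hρ.isBoundedMeasurable hHreg hLreg)).intervalIntegrable_trace_re hτ.le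
  have key := trace_cfc_sub_le_integral hτ.le hherm hI hφ hψ hK
    (hρ.ae_hasDerivAt hHreg hLreg hτ.le)
    ((hheat.const_mul (-β)).add (hact.const_mul (l ^ 2 / 2)))
    (fun t ht => trace_lindbladian_mul_cfc_le hrev (hH t ht) (hherm t ht)
      (fun i => hc.trans_le (hI t ht ((hherm t ht).eigenvalues_mem_spectrum_real i)).1)
      (fun k => (hω t ht k).1) (fun k => (hω t ht k).2) hl hsign)
  -- At time `0` the trace norm term is zero, so the increment of `Tr φ` is exactly the left side of
  -- the bound.
  rw [trace_mul_log_add_smul_abs (hherm τ ⟨hτ.le, le_rfl⟩), trace_mul_log_add_smul_abs hρ0h,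
    ← maximallyMixed_eq, ← hρ0, sub_self, traceNorm_zero,
    intervalIntegral.integral_add (hheat.const_mul _) (hact.const_mul _),
    intervalIntegral.integral_const_mul, intervalIntegral.integral_const_mul] at key
  rw [dissipatedHeat_eq hρ hHreg hLreg hτ.le, meanActivity, entropyDecrease,
    mul_inv_cancel_left₀ hτ.ne']
  linarith

lemma meanActivity_nonneg (hτ : 0 < τ)
    (hH : ∀ t ∈ Icc 0 τ, (H t).IsHermitian) (hHreg : IsBoundedMeasurable τ H)
    (hLreg : ∀ k, IsBoundedMeasurable τ (L k))
    (hρ : IsLindbladSolution τ H L ρ) (hρ0 : ρ 0 = maximallyMixed d) :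
    0 ≤ meanActivity τ L ρ := by
  have hρ0h : (ρ 0).IsHermitian := hρ0 ▸ maximallyMixed_isHermitian
  obtain ⟨c, hc, hspec⟩ := hρ.spectrum_subset_Ici hHreg hLreg hH hρ0h
    (c := ((d : ℝ) + 1)⁻¹) (by positivity) (hρ0 ▸ spectrum_maximallyMixed_subset)
  refine mul_nonneg (inv_nonneg.mpr hτ.le) (intervalIntegral.integral_nonneg hτ.le fun t ht =>
    Finset.sum_nonneg fun k _ => ?_)
  have hherm := hρ.isHermitian hHreg hLreg hH hρ0h ht
  rw [trace_mul_conjTranspose_mul, trace_activity hherm, Complex.ofReal_re]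
  exact Finset.sum_nonneg fun i _ => Finset.sum_nonneg fun j _ =>
    mul_nonneg (transitionWeight_nonneg _ _ _ _ _)
      (hc.le.trans (hspec t ht (hherm.eigenvalues_mem_spectrum_real j)))

end Landauer

end QuantumLandauer

/-! ### Optimization over the parameter and the reset error -/

theorem mainTheorem1 {d : ℕ} {κ : Type*} [Fintype κ] (β τ : ℝ) (hβ : 0 < β) (hτ : 0 < τ)
    (H : ℝ → Matrix (Fin d) (Fin d) ℂ) (L : κ → ℝ → Matrix (Fin d) (Fin d) ℂ)
    (ρ : ℝ → Matrix (Fin d) (Fin d) ℂ)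
    (hH : ∀ t ∈ Set.Icc 0 τ, (H t).IsHermitian)
    (hHreg : QuantumLandauer.IsBoundedMeasurable τ H)
    (hLreg : ∀ k, QuantumLandauer.IsBoundedMeasurable τ (L k))
    (hDB : QuantumLandauer.DetailedBalance β τ H L)
    (hρ : QuantumLandauer.IsLindbladSolution τ H L ρ)
    (hρ0 : ρ 0 = QuantumLandauer.maximallyMixed d) :
    (β * QuantumLandauer.dissipatedHeat τ H ρ ≥
      QuantumLandauer.entropyDecrease τ ρ +
        QuantumLandauer.traceNorm (ρ 0 - ρ τ) ^ 2 /
          (2 * τ * QuantumLandauer.meanActivity τ L ρ)) ∧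
    ∀ (ψ : Fin d → ℂ) (ε : ℝ), star ψ ⬝ᵥ ψ = 1 →
      ε = QuantumLandauer.traceNorm (ρ τ - QuantumLandauer.ketbra ψ) →
      (QuantumLandauer.entropyDecrease τ ρ +
          QuantumLandauer.traceNorm (ρ 0 - ρ τ) ^ 2 /
            (2 * τ * QuantumLandauer.meanActivity τ L ρ) ≥
        QuantumLandauer.entropyDecrease τ ρ +
          (2 * (1 - 1 / (d : ℝ)) - ε) ^ 2 /
            (2 * τ * QuantumLandauer.meanActivity τ L ρ)) ∧
      β * QuantumLandauer.dissipatedHeat τ H ρ ≥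
        QuantumLandauer.entropyDecrease τ ρ +
          (2 * (1 - 1 / (d : ℝ)) - ε) ^ 2 /
            (2 * τ * QuantumLandauer.meanActivity τ L ρ) := by
  open QuantumLandauer in
  have hγ : 0 ≤ meanActivity τ L ρ := meanActivity_nonneg hτ hH hHreg hLreg hρ hρ0
  have hρ0h : (ρ 0).IsHermitian := hρ0 ▸ maximallyMixed_isHermitian
  have hρτh : (ρ τ).IsHermitian :=
    hρ.isHermitian hHreg hLreg hH hρ0h ⟨hτ.le, le_rfl⟩
  have hnorm : 0 ≤ traceNorm (ρ 0 - ρ τ) := traceNorm_nonneg (hρ0h.sub hρτh)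
  have hLeg := fun {l : ℝ} (hl : 0 ≤ l) =>
    entropyDecrease_add_mul_traceNorm_le hτ hH hHreg hLreg hDB hρ hρ0 hl
  have hfirst : entropyDecrease τ ρ + traceNorm (ρ 0 - ρ τ) ^ 2 /
      (2 * τ * meanActivity τ L ρ) ≤ β * dissipatedHeat τ H ρ := by
    rcases hγ.eq_or_lt with h0 | h0
    -- With zero activity the quotient is `0` by division by zero, and `l = 0` is enough.
    · simpa [← h0] using hLeg le_rfl
    -- The maximizer of `l ‖ρ₀ - ρ_τ‖₁ - (l² / 2) τ γ̄`.
    have h := hLeg (l := traceNorm (ρ 0 - ρ τ) / (τ * meanActivity τ L ρ)) (by positivity)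
    have e : traceNorm (ρ 0 - ρ τ) / (τ * meanActivity τ L ρ) * traceNorm (ρ 0 - ρ τ) -
        (traceNorm (ρ 0 - ρ τ) / (τ * meanActivity τ L ρ)) ^ 2 / 2 * (τ * meanActivity τ L ρ) =
        traceNorm (ρ 0 - ρ τ) ^ 2 / (2 * τ * meanActivity τ L ρ) := by
      field_simp
      ring
    linarith
  refine ⟨hfirst, fun ψ ε hψ hε => ?_⟩
  have hP := ketbra_isHermitian ψ
  -- The reverse triangle inequality bounds the absolute value of `2 (1 - 1/d) - ε`, so squaring is
  -- legitimate even when this number is negative.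
  have htri := abs_traceNorm_sub_traceNorm_le (hρ0h.sub hP) (hρτh.sub hP)
  rw [sub_sub_sub_cancel_right, ← hε, hρ0, traceNorm_maximallyMixed_sub_ketbra hψ, ← hρ0] at htri
  have hsq : (2 * (1 - 1 / (d : ℝ)) - ε) ^ 2 ≤ traceNorm (ρ 0 - ρ τ) ^ 2 :=
    sq_le_sq.mpr (by rwa [abs_of_nonneg hnorm])
  have hsecond : entropyDecrease τ ρ + (2 * (1 - 1 / (d : ℝ)) - ε) ^ 2 /
      (2 * τ * meanActivity τ L ρ) ≤ entropyDecrease τ ρ + traceNorm (ρ 0 - ρ τ) ^ 2 /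
      (2 * τ * meanActivity τ L ρ) := by gcongr
  exact ⟨hsecond, hsecond.trans hfirst⟩
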